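/- **Setting.** Let $\mathsf k$ be a commutative ring containing $\mathbb Q$. Let $F$ be a compact connected oriented smooth surface whose boundary, possibly empty, is parametrized by $r\ge 0$ circles. A *diagram* on $F$ is a pair $(D,C)$, where $D$ is a properly immersed compact smooth $1$-manifold in $F$ (closed curves and arcs) whose only singularities are transversal double points in the interior, with over/under information at each of these crossings, whose endpoints on the $i$-th boundary circle are the $j_i$-th roots of unity for some $j_i\ge 0$, and where $C$ is a subset of the set of crossings of $D$. Diagrams are considered up to isotopy of $F$ fixing $\partial F$ pointwise; $\mathcal D(F)$ is the set of isotopy classes. A diagram is *real* if $C$ is the set of all crossings. A closed component without crossings is *trivial* if it bounds a disc in $F$. Let $\mathfrak C^a(F)$ be the set of isotopy classes of diagrams without crossings and without trivial components (curve systems). Every crossing has a $0$-smoothing and an $\infty$-smoothing: if the plane is drawn with the given orientation and the over-crossing strand has slope $+1$, the $0$-smoothing consists of a left and a right arc, $)($, and the $\infty$-smoothing of an upper and a lower arc. **Bracket.** A Kauffman state $\sigma$ of $D$ assigns a marker $0$ or $\infty$ to each crossing of $D$; let $\zeta(\sigma)$ and $\iota(\sigma)$ be the numbers of $0$- and $\infty$-markers,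 $\mu(\sigma)$ the number of trivial components of the smoothing of $D$ according to $\sigma$, and $D_\sigma\in\mathfrak C^a(F)$ the result of discarding these components. The Kauffman bracket is $$\langle D\rangle=\sum_\sigma(-t)^{\zeta(\sigma)-\iota(\sigma)}(-t^2-t^{-2})^{\mu(\sigma)}D_\sigma\in\mathsf k[t,t^{-1}]\,\mathfrak C^a(F).$$ Substituting $t=e^h$, let $\langle D\rangle_k\in\mathsf k\,\mathfrak C^a(F)$ be its coefficient of $h^k$. **Resolution operators.** For $P=\sum_{i,l}a_{i,l}z^iw^l\in\mathsf k[z,w]$ let $\chi(P)$ be the endomorphism of the free module $\mathsf k\,\mathcal D(F)$ with $$\chi(P)[D,C]=\sum_{m\ge0}(-1)^m\sum_{T\subseteq C,\ |T|=m}\ \sum_{\sigma:T\to\{0,\infty\}}a_{\iota(\sigma),\,m-\iota(\sigma)}\,[D(\sigma),C\setminus T],$$ where $\iota(\sigma)=|\sigma^{-1}(\infty)|$ and $D(\sigma)$ is the diagram obtained from $D$ by smoothing the crossings in $T$ according to $\sigma$. For $\varphi:\mathbb N\to\mathsf k$ let $\varphi_*:\mathsf k\,\mathcal D(F)\to\mathsf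 k\,\mathfrak C^a(F)$ be the linear map $$\varphi_*[D,C]=(-1)^{c(D)}\sum_\sigma\varphi(\mu(\sigma))\,D_\sigma ,$$ the sum being over all Kauffman states of $D$, and $c(D)$ being the number of crossings of $D$. Let $\varphi_j(i)\in\mathbb Q$ be the coefficient of $h^{2j}$ in $(-t^2-t^{-2})^i$, $t=e^h$. **Theorem.** There are polynomials $P_k\in\mathbb Q[z,w]$, $k\ge0$, independent of $\mathsf k$ and $F$, such that $P_k$ has degree $k$, is not homogeneous for $k>1$, has homogeneous component of degree $k$ equal to $$w^k-zw^{k-1}+z^2w^{k-2}-\dots+(-1)^kz^k,$$ and such that for every real diagram $D$ on $F$ (arcs allowed) and every $k\ge0$ $$\langle D\rangle_k=\sum_{j=0}^{\lfloor k/2\rfloor}\big((\varphi_j)_*\circ\chi(P_{k-2j})\big)(D)\in\mathbb Q\,\mathfrak C^a(F)\subset\mathsf k\,\mathfrak C^a(F).$$ -/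

import Mathlib

open scoped Manifold ContDiff Topology

noncomputable section

namespace KauffmanExpansion

/-! ### Surfaces -/

abbrev Plane : Type := EuclideanSpace ℝ (Fin 2)

abbrev HalfPlane : Type := EuclideanHalfSpace 2

/-- Compact connected oriented smooth surfaces, possibly with boundary. The orientation is the
one for which the charts of the given atlas are positive: all coordinate changes have positive
Jacobian determinant. -/
class OrientedSurface (F : Type*) [TopologicalSpace F] [ChartedSpace HalfPlane F] : Prop where
  t2 : T2Space F
  compact : CompactSpace F
  connected : ConnectedSpace F
  smooth : IsManifold (𝓡∂ 2) ∞ F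
  oriented : ∀ e ∈ atlas HalfPlane F, ∀ e' ∈ atlas HalfPlane F, ∀ x ∈ (e.symm.trans e').source,
    0 < (fderivWithin ℝ (fun v : Plane => (𝓡∂ 2) ((e.symm.trans e') ((𝓡∂ 2).symm v)))
      (Set.range (𝓡∂ 2)) ((𝓡∂ 2) x)).det

attribute [instance] OrientedSurface.t2 OrientedSurface.compact OrientedSurface.connected
  OrientedSurface.smooth

/-- A parametrization of `∂F` by `r ≥ 0` disjoint smoothly embedded circles. -/
structure BoundaryParametrization (F : Type*) [TopologicalSpace F] [ChartedSpace HalfPlane F]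
    (r : ℕ) where
  toFun : Fin r → Circle → F
  contMDiff : ∀ i, ContMDiff (𝓡 1) (𝓡∂ 2) ∞ (toFun i)
  immersion : ∀ i z, Function.Injective (mfderiv (𝓡 1) (𝓡∂ 2) (toFun i) z)
  injective : Function.Injective (fun p : Fin r × Circle => toFun p.1 p.2)
  range_eq : (⋃ i, Set.range (toFun i)) = (𝓡∂ 2).boundary F

section Isotopy

variable {F : Type*} [TopologicalSpace F] [ChartedSpace HalfPlane F]

/-- `φ` is the end of a smooth isotopy of `F` which starts at the identity and fixes `∂F`
pointwise. -/
def IsotopicToId (φ : F ≃ₘ^∞⟮𝓡∂ 2, 𝓡∂ 2⟯ F) : Prop :=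
  ∃ H : ℝ → (F ≃ₘ^∞⟮𝓡∂ 2, 𝓡∂ 2⟯ F),
    ContMDiff ((𝓘(ℝ, ℝ)).prod (𝓡∂ 2)) (𝓡∂ 2) ∞ (fun p : ℝ × F => H p.1 p.2) ∧
    (∀ x, H 0 x = x) ∧ (∀ x, H 1 x = φ x) ∧
    ∀ t, ∀ x ∈ (𝓡∂ 2).boundary F, H t x = x

theorem isotopicToId_refl : IsotopicToId (Diffeomorph.refl (𝓡∂ 2) F ∞) :=
  ⟨fun _ => Diffeomorph.refl (𝓡∂ 2) F ∞, contMDiff_snd, fun _ => rfl, fun _ => rfl,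
    fun _ _ _ => rfl⟩

theorem IsotopicToId.trans {φ ψ : F ≃ₘ^∞⟮𝓡∂ 2, 𝓡∂ 2⟯ F} (hφ : IsotopicToId φ)
    (hψ : IsotopicToId ψ) : IsotopicToId (φ.trans ψ) := by
  obtain ⟨H, hH, H0, H1, Hb⟩ := hφ
  obtain ⟨K, hK, K0, K1, Kb⟩ := hψ
  refine ⟨fun t => (H t).trans (K t), ?_, fun x => ?_, fun x => ?_, fun t x hx => ?_⟩
  · exact hK.comp (contMDiff_fst.prodMk hH)
  · simp [H0, K0]
  · simp [H1, K1]
  · simp [Hb t x hx, Kb t x hx]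

theorem IsotopicToId.symm {φ : F ≃ₘ^∞⟮𝓡∂ 2, 𝓡∂ 2⟯ F} (hφ : IsotopicToId φ) :
    IsotopicToId φ.symm := by
  obtain ⟨H, hH, H0, H1, Hb⟩ := hφ
  have hb : ∀ x ∈ (𝓡∂ 2).boundary F, φ.symm x = x := fun x hx => by
    conv_lhs => rw [← Hb 1 x hx, H1, Diffeomorph.symm_apply_apply]
  refine ⟨fun t => φ.symm.trans (H (1 - t)), ?_, fun x => ?_, fun x => ?_, fun t x hx => ?_⟩
  · have h1 : ContMDiff 𝓘(ℝ, ℝ) 𝓘(ℝ, ℝ) ∞ (fun t : ℝ => 1 - t) :=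
      (contDiff_const.sub contDiff_id).contMDiff
    exact hH.comp ((h1.comp contMDiff_fst).prodMk (φ.symm.contMDiff.comp contMDiff_snd))
  · simp [H1]
  · simp [H0]
  · simp [hb x hx, Hb _ x hx]

end Isotopy

/-! ### Local models -/

/-- The model of a crossing: the two diagonals. -/
def crossModel : Set Plane := {x | x 0 ^ 2 = x 1 ^ 2}

/-- A smooth positive function on `[0, ∞)` which is the identity on `[1, ∞)`. -/
def profile (u : ℝ) : ℝ := u + (1 - Real.smoothTransition u) * (1 - u) / 2

/-- The `0`-smoothing `)(` of `crossModel`: a left and a right arc. -/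
def zeroModel : Set Plane := {x | x 0 ^ 2 = profile (x 1 ^ 2)}

/-- The `∞`-smoothing of `crossModel`: an upper and a lower arc. -/
def inftyModel : Set Plane := {x | x 1 ^ 2 = profile (x 0 ^ 2)}

/-- The disc in which a smoothing takes place: outside it, the three models coincide. -/
def core : Set Plane := Metric.closedBall 0 2

theorem profile_pos {u : ℝ} (hu : 0 ≤ u) : 0 < profile u := by
  unfold profile
  have h0 := Real.smoothTransition.nonneg u
  have h1 := Real.smoothTransition.le_one u
  rcases le_or_gt 1 u with h | h
  · rw [Real.smoothTransition.one_of_one_le h]; linarith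
  · rcases hu.eq_or_lt with rfl | hu
    · simp [Real.smoothTransition.zero]
    · have := mul_nonneg (sub_nonneg.2 h1) (sub_pos.2 h).le
      linarith

theorem profile_le {u : ℝ} (h : u ≤ 1) : profile u ≤ 1 := by
  unfold profile
  have h0 := Real.smoothTransition.nonneg u
  nlinarith

theorem profile_eq {u : ℝ} (h : 1 ≤ u) : profile u = u := by
  simp [profile, Real.smoothTransition.one_of_one_le h]

theorem profile_contDiff : ContDiff ℝ ∞ profile := by
  unfold profile
  have : ContDiff ℝ ∞ Real.smoothTransition := Real.smoothTransition.contDiff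
  fun_prop

theorem not_mem_core {x : Plane} (hx : x ∉ core) : 4 < x 0 ^ 2 + x 1 ^ 2 := by
  have h : 2 < ‖x‖ := by simpa [core] using hx
  have h2 : ‖x‖ ^ 2 = x 0 ^ 2 + x 1 ^ 2 := by
    rw [EuclideanSpace.norm_sq_eq]; simp [Fin.sum_univ_two]
  nlinarith

theorem profile_iff {u v : ℝ} (h : 4 < u + v) : v = profile u ↔ v = u := by
  rcases le_or_gt 1 u with h1 | h1
  · rw [profile_eq h1]
  · have := profile_le h1.le
    constructor <;> intro <;> linarith

theorem zeroModel_iff {x : Plane} (hx : x ∉ core) : x ∈ zeroModel ↔ x ∈ crossModel := by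
  have h := not_mem_core hx
  exact profile_iff (by linarith)

theorem inftyModel_iff {x : Plane} (hx : x ∉ core) : x ∈ inftyModel ↔ x ∈ crossModel := by
  have h := not_mem_core hx
  exact (profile_iff (by linarith)).trans eq_comm

open Classical in
/-- The smoothing of `crossModel` with marker `∞` if `b` holds, and with marker `0` otherwise. -/
def smoothModel (b : Prop) : Set Plane := if b then inftyModel else zeroModel

theorem smoothModel_iff (b : Prop) {x : Plane} (hx : x ∉ core) :
    x ∈ smoothModel b ↔ x ∈ crossModel := by
  by_cases hb : b <;> simp [smoothModel, hb, zeroModel_iff hx, inftyModel_iff hx]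

theorem neg_mem_core {x : Plane} : -x ∈ core ↔ x ∈ core := by simp [core]

theorem neg_mem_smoothModel (b : Prop) {x : Plane} :
    -x ∈ smoothModel b ↔ x ∈ smoothModel b := by
  by_cases hb : b <;> simp [smoothModel, zeroModel, inftyModel, hb]

theorem isCompact_core : IsCompact core := isCompact_closedBall _ _

theorem zero_mem_core : (0 : Plane) ∈ core := by simp [core]

theorem zero_mem_crossModel : (0 : Plane) ∈ crossModel := by simp [crossModel]

theorem isClosed_smoothModel (b : Prop) : IsClosed (smoothModel b) := by
  have hp := profile_contDiff.continuous
  by_cases hb : b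
  · simp only [smoothModel, hb, if_true]
    exact isClosed_eq (by fun_prop) (by fun_prop)
  · simp only [smoothModel, hb, if_false]
    exact isClosed_eq (by fun_prop) (by fun_prop)

theorem isPreconnected_crossModel : IsPreconnected crossModel := by
  have h : StarConvex ℝ (0 : Plane) crossModel := by
    intro y hy a b ha hb hab
    have hy : y 0 ^ 2 = y 1 ^ 2 := hy
    change (a • (0 : Plane) + b • y) 0 ^ 2 = (a • (0 : Plane) + b • y) 1 ^ 2
    simp [mul_pow, hy]
  exact (StarConvex.isPathConnected h zero_mem_crossModel).isConnected.isPreconnected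

end KauffmanExpansion

namespace KauffmanExpansion

/-! ### Diagrams -/

section Diagram

variable {F : Type*} [TopologicalSpace F] [ChartedSpace HalfPlane F]

/-- `e` is a smooth open embedding of the plane into `F`. -/
structure IsOpenDisc (e : Plane → F) : Prop where
  injective : Function.Injective e
  isLocalDiffeomorph : IsLocalDiffeomorph 𝓘(ℝ, Plane) (𝓡∂ 2) ∞ e

/-- The embedding `e` is compatible with the orientation of `F`. -/
def IsPositive (e : Plane → F) : Prop :=
  ∀ x, 0 < (fderiv ℝ (fun v : Plane => extChartAt (𝓡∂ 2) (e x) (e v)) x).det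

/-- Near `p`, the set `D` is a properly embedded smooth arc: in suitable coordinates it is a line
in the plane or, if `p` is on the boundary, the ray normal to the boundary of the half plane. -/
def IsArcPoint (D : Set F) (p : F) : Prop :=
  (∃ e : Plane → F, IsLocalDiffeomorphAt 𝓘(ℝ, Plane) (𝓡∂ 2) ∞ e 0 ∧ e 0 = p ∧
    ∀ᶠ x in 𝓝 0, (e x ∈ D ↔ x 1 = 0)) ∨
  (∃ e : HalfPlane → F, IsLocalDiffeomorphAt (𝓡∂ 2) (𝓡∂ 2) ∞ e 0 ∧ e 0 = p ∧
    ∀ᶠ x in 𝓝 0, (e x ∈ D ↔ x.1 1 = 0))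

theorem IsArcPoint.congr {D D' : Set F} {p : F} (h : IsArcPoint D p)
    (hD : ∀ᶠ q in 𝓝 p, (q ∈ D ↔ q ∈ D')) : IsArcPoint D' p := by
  rcases h with ⟨e, he, rfl, h⟩ | ⟨e, he, rfl, h⟩
  · refine Or.inl ⟨e, he, rfl, ?_⟩
    filter_upwards [h, he.contMDiffAt.continuousAt.eventually hD] with x h1 h2
    rw [← h2, h1]
  · refine Or.inr ⟨e, he, rfl, ?_⟩
    filter_upwards [h, he.contMDiffAt.continuousAt.eventually hD] with x h1 h2
    rw [← h2, h1]

theorem IsOpenDisc.isOpen_range {e : Plane → F} (he : IsOpenDisc e) : IsOpen (Set.range e) :=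
  he.isLocalDiffeomorph.isOpen_range

theorem IsOpenDisc.continuous {e : Plane → F} (he : IsOpenDisc e) : Continuous e :=
  he.isLocalDiffeomorph.contMDiff.continuous

theorem IsOpenDisc.not_mem_boundary [IsManifold (𝓡∂ 2) ∞ F] {e : Plane → F}
    (he : IsOpenDisc e) (x : Plane) : e x ∉ (𝓡∂ 2).boundary F := by
  have h := ((he.isLocalDiffeomorph x).isBoundaryPoint_iff (by simp)).not.1
    ((ModelWithCorners.isInteriorPoint_iff_not_isBoundaryPoint x).1
      BoundarylessManifold.isInteriorPoint)
  exact h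

variable {r : ℕ}

/-- A pair `(D, C)` of a diagram `D` on `F` and a subset `C` (`marked`) of its crossings.

The projection `carrier` is a properly immersed compact smooth `1`-manifold whose only
singularities are transversal double points, the crossings. Each crossing `c` comes with a
positively oriented coordinate disc `chart c` in which the projection consists of the two
diagonals `x₀ = ± x₁`; the crossing information is that the over-crossing strand is `x₀ = x₁`.
The coordinate discs are auxiliary data: up to isotopy and half-turns they are determined by the
diagram. The values of `chart` outside the crossings are irrelevant. The boundary points on the
`i`-th boundary circle are the `jᵢ`-th roots of unity for some `jᵢ ≥ 0`. -/
structure Diagram (β : BoundaryParametrization F r) where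
  carrier : Set F
  isClosed : IsClosed carrier
  crossings : Finset F
  chart : F → Plane → F
  chart_zero : ∀ c ∈ crossings, chart c 0 = c
  isOpenDisc_chart : ∀ c ∈ crossings, IsOpenDisc (chart c)
  isPositive_chart : ∀ c ∈ crossings, IsPositive (chart c)
  preimage_chart : ∀ c ∈ crossings, chart c ⁻¹' carrier = crossModel
  disjoint_charts : ∀ c ∈ crossings, ∀ c' ∈ crossings, c ≠ c' →
    Disjoint (Set.range (chart c)) (Set.range (chart c'))
  isArcPoint : ∀ p ∈ carrier, p ∉ crossings → IsArcPoint carrier p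
  boundary_pattern : ∃ j : Fin r → ℕ, ∀ i, carrier ∩ Set.range (β.toFun i) =
    {p | ∃ l : ℕ, 1 ≤ l ∧ l ≤ j i ∧ p = β.toFun i (Circle.exp (2 * Real.pi * l / j i))}
  marked : Finset F
  marked_subset : marked ⊆ crossings

namespace Diagram

variable {β : BoundaryParametrization F r} (D : Diagram β)

/-- Isotopy of diagrams: an isotopy of `F` fixing `∂F` pointwise, which takes projection,
crossings, crossing information (coordinate discs, up to half-turns) and marked crossings of `D`
to those of `D'`. -/
def Isotopic (D D' : Diagram β) : Prop :=
  ∃ φ : F ≃ₘ^∞⟮𝓡∂ 2, 𝓡∂ 2⟯ F, IsotopicToId φ ∧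
    φ '' D.carrier = D'.carrier ∧
    D.crossings.map φ.toEquiv.toEmbedding = D'.crossings ∧
    D.marked.map φ.toEquiv.toEmbedding = D'.marked ∧
    ∀ c ∈ D.crossings, (∀ x ∈ core, φ (D.chart c x) = D'.chart (φ c) x) ∨
      (∀ x ∈ core, φ (D.chart c x) = D'.chart (φ c) (-x))

theorem Isotopic.refl (D : Diagram β) : D.Isotopic D :=
  ⟨Diffeomorph.refl _ _ _, isotopicToId_refl, by simp, by ext; simp, by ext; simp,
    fun _ _ => Or.inl fun _ _ => rfl⟩

theorem Isotopic.trans {D D' D'' : Diagram β} (h : D.Isotopic D') (h' : D'.Isotopic D'') :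
    D.Isotopic D'' := by
  obtain ⟨φ, hφ, h1, h2, h3, h4⟩ := h
  obtain ⟨ψ, hψ, k1, k2, k3, k4⟩ := h'
  refine ⟨φ.trans ψ, hφ.trans hψ, ?_, ?_, ?_, ?_⟩
  · rw [← k1, ← h1, Set.image_image]; rfl
  · rw [← k2, ← h2, Finset.map_map]; rfl
  · rw [← k3, ← h3, Finset.map_map]; rfl
  · intro c hc
    have hc' : φ c ∈ D'.crossings := by
      rw [← h2]; exact Finset.mem_map_of_mem φ.toEquiv.toEmbedding hc
    simp only [Diffeomorph.coe_trans, Function.comp_apply]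
    rcases h4 c hc with h | h <;> rcases k4 _ hc' with k | k
    · exact Or.inl fun x hx => by rw [h x hx, k x hx]
    · exact Or.inr fun x hx => by rw [h x hx, k x hx]
    · exact Or.inr fun x hx => by rw [h x hx, k _ (neg_mem_core.2 hx)]
    · exact Or.inl fun x hx => by rw [h x hx, k _ (neg_mem_core.2 hx), neg_neg]

theorem Isotopic.symm {D D' : Diagram β} (h : D.Isotopic D') : D'.Isotopic D := by
  obtain ⟨φ, hφ, h1, h2, h3, h4⟩ := h
  refine ⟨φ.symm, hφ.symm, ?_, ?_, ?_, ?_⟩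
  · rw [← h1, Set.image_image]; simp
  · rw [← h2, Finset.map_map]
    convert Finset.map_refl
    ext x; exact φ.symm_apply_apply x
  · rw [← h3, Finset.map_map]
    convert Finset.map_refl
    ext x; exact φ.symm_apply_apply x
  · rw [← h2]
    intro c hc
    obtain ⟨c, hc', rfl⟩ := Finset.mem_map.1 hc
    have : φ.symm (φ.toEquiv.toEmbedding c) = c := φ.symm_apply_apply c
    rw [this]
    change (∀ x ∈ core, φ.symm (D'.chart (φ c) x) = _) ∨
      (∀ x ∈ core, φ.symm (D'.chart (φ c) x) = _)
    rcases h4 c hc' with h | h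
    · exact Or.inl fun x hx => by rw [← h x hx, φ.symm_apply_apply]
    · refine Or.inr fun x hx => ?_
      have := h _ (neg_mem_core.2 hx)
      rw [neg_neg] at this
      rw [← this, φ.symm_apply_apply]

instance setoid (β : BoundaryParametrization F r) : Setoid (Diagram β) :=
  ⟨Isotopic, Isotopic.refl, Isotopic.symm, Isotopic.trans⟩

/-- `(D, C)` is a real diagram if `C` is the set of all crossings. -/
def IsReal : Prop := D.marked = D.crossings

end Diagram

end Diagram

end KauffmanExpansion

namespace KauffmanExpansion

section Smoothing

variable {F : Type*} [TopologicalSpace F] [ChartedSpace HalfPlane F]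

theorem profile_shear_isLocalDiffeomorph (a s : ℝ) :
    IsLocalDiffeomorph 𝓘(ℝ, Plane) 𝓘(ℝ, Plane) ∞
      (fun v : Plane => !₂[a + v 0, v 1 + s * √(profile ((a + v 0) ^ 2))]) := by
  have hs : ContDiff ℝ ∞ (fun t : ℝ => √(profile (t ^ 2))) :=
    (profile_contDiff.comp (contDiff_id.pow 2)).sqrt fun t => (profile_pos (sq_nonneg t)).ne'
  have h0 : ContDiff ℝ ∞ (fun v : Plane => v 0) := by fun_prop
  have h1 : ContDiff ℝ ∞ (fun v : Plane => v 1) := by fun_prop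
  have hs1 : ContDiff ℝ ∞ (fun v : Plane => √(profile ((a + v 0) ^ 2))) :=
    hs.comp (contDiff_const.add h0)
  have hs2 : ContDiff ℝ ∞ (fun v : Plane => √(profile (v 0 ^ 2))) := hs.comp h0
  let Φ : Plane ≃ₘ^∞⟮𝓘(ℝ, Plane), 𝓘(ℝ, Plane)⟯ Plane :=
    { toFun := fun v => !₂[a + v 0, v 1 + s * √(profile ((a + v 0) ^ 2))]
      invFun := fun v => !₂[v 0 - a, v 1 - s * √(profile (v 0 ^ 2))]
      left_inv := fun v => by ext i; fin_cases i <;> simp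
      right_inv := fun v => by ext i; fin_cases i <;> simp
      contMDiff_toFun := by
        refine ContDiff.contMDiff ((contDiff_piLp 2).2 fun i => ?_)
        fin_cases i
        · exact contDiff_const.add h0
        · exact h1.add (contDiff_const.mul hs1)
      contMDiff_invFun := by
        refine ContDiff.contMDiff ((contDiff_piLp 2).2 fun i => ?_)
        fin_cases i
        · exact h0.sub contDiff_const
        · exact h1.sub (contDiff_const.mul hs2) }
  exact Φ.isLocalDiffeomorph

theorem swap_isLocalDiffeomorph :
    IsLocalDiffeomorph 𝓘(ℝ, Plane) 𝓘(ℝ, Plane) ∞ (fun v : Plane => !₂[v 1, v 0]) := by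
  let Φ : Plane ≃ₘ^∞⟮𝓘(ℝ, Plane), 𝓘(ℝ, Plane)⟯ Plane :=
    { toFun := fun v => !₂[v 1, v 0]
      invFun := fun v => !₂[v 1, v 0]
      left_inv := fun v => by ext i; fin_cases i <;> simp
      right_inv := fun v => by ext i; fin_cases i <;> simp
      contMDiff_toFun := by
        refine ContDiff.contMDiff ((contDiff_piLp 2).2 fun i => ?_)
        fin_cases i <;> simp <;> fun_prop
      contMDiff_invFun := by
        refine ContDiff.contMDiff ((contDiff_piLp 2).2 fun i => ?_)
        fin_cases i <;> simp <;> fun_prop }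
  exact Φ.isLocalDiffeomorph

theorem exists_chart_inftyModel {x : Plane} (hx : x ∈ inftyModel) :
    ∃ e : Plane → Plane, IsLocalDiffeomorph 𝓘(ℝ, Plane) 𝓘(ℝ, Plane) ∞ e ∧ e 0 = x ∧
      ∀ᶠ v in 𝓝 0, (e v ∈ inftyModel ↔ v 1 = 0) := by
  have hx : x 1 ^ 2 = profile (x 0 ^ 2) := hx
  have hpos := profile_pos (sq_nonneg (x 0))
  obtain ⟨s, hs, hxs⟩ : ∃ s : ℝ, s ^ 2 = 1 ∧ x 1 = s * √(profile (x 0 ^ 2)) := by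
    rw [← hx, Real.sqrt_sq_eq_abs]
    rcases abs_cases (x 1) with ⟨h, -⟩ | ⟨h, -⟩
    · exact ⟨1, by norm_num, by rw [h]; ring⟩
    · exact ⟨-1, by norm_num, by rw [h]; ring⟩
  have he := profile_shear_isLocalDiffeomorph (x 0) s
  refine ⟨_, he, ?_, ?_⟩
  · ext i; fin_cases i <;> simp [hxs]
  · have hc : Continuous (fun v : Plane => v 1 + 2 * s * √(profile ((x 0 + v 0) ^ 2))) := by
      have := profile_contDiff.continuous
      fun_prop
    have hne : (fun v : Plane => v 1 + 2 * s * √(profile ((x 0 + v 0) ^ 2))) 0 ≠ 0 := by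
      have h1 : s ≠ 0 := by rintro rfl; norm_num at hs
      have h2 := (Real.sqrt_pos.2 hpos).ne'
      simp [h1, h2]
    filter_upwards [hc.continuousAt.eventually_ne hne] with v hv
    have hq := Real.sq_sqrt (profile_pos (sq_nonneg (x 0 + v 0))).le
    change (v 1 + s * √(profile ((x 0 + v 0) ^ 2))) ^ 2 = profile ((x 0 + v 0) ^ 2) ↔ v 1 = 0
    constructor
    · intro h
      have : v 1 * (v 1 + 2 * s * √(profile ((x 0 + v 0) ^ 2))) = 0 := by
        have h3 : s ^ 2 * √(profile ((x 0 + v 0) ^ 2)) ^ 2 = profile ((x 0 + v 0) ^ 2) := by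
          rw [hs, hq, one_mul]
        linear_combination h - h3
      exact (mul_eq_zero.1 this).resolve_right hv
    · intro h
      rw [h, zero_add, mul_pow, hs, hq, one_mul]

theorem exists_chart_smoothModel (b : Prop) {x : Plane} (hx : x ∈ smoothModel b) :
    ∃ e : Plane → Plane, IsLocalDiffeomorph 𝓘(ℝ, Plane) 𝓘(ℝ, Plane) ∞ e ∧ e 0 = x ∧
      ∀ᶠ v in 𝓝 0, (e v ∈ smoothModel b ↔ v 1 = 0) := by
  by_cases hb : b
  · simp only [smoothModel, hb, if_true] at hx ⊢
    exact exists_chart_inftyModel hx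
  · simp only [smoothModel, hb, if_false] at hx ⊢
    have hx' : !₂[x 1, x 0] ∈ inftyModel := hx
    obtain ⟨e, he, h0, h⟩ := exists_chart_inftyModel hx'
    refine ⟨fun v => !₂[e v 1, e v 0], fun v => (he v).comp _ _ (swap_isLocalDiffeomorph (e v)), ?_, h⟩
    simp only [h0]
    ext i; fin_cases i <;> simp

theorem isArcPoint_of_model {e : Plane → F} (he : IsOpenDisc e) {A : Set F} (b : Prop)
    (h : ∀ x, e x ∈ A ↔ x ∈ smoothModel b) {x : Plane} (hx : x ∈ smoothModel b) :
    IsArcPoint A (e x) := by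
  obtain ⟨f, hf, h0, hf'⟩ := exists_chart_smoothModel b hx
  refine Or.inl ⟨e ∘ f, (hf 0).comp _ _ (he.isLocalDiffeomorph _), by simp [h0], ?_⟩
  filter_upwards [hf'] with v hv
  rw [← hv]; exact h _

namespace Diagram

variable {r : ℕ} {β : BoundaryParametrization F r} (D : Diagram β)

/-- The projection which results from smoothing the crossings in `T`, with marker `∞` at those in
`I` and marker `0` at those not in `I`. -/
def smoothCarrier (T I : Finset F) : Set F :=
  {p | p ∈ D.carrier ∧ ∀ c ∈ D.crossings, c ∈ T → p ∉ D.chart c '' core} ∪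
    {p | ∃ c ∈ D.crossings, c ∈ T ∧ p ∈ D.chart c '' (smoothModel (c ∈ I) ∩ core)}

variable {D}

theorem eq_of_chart_eq {c c' : F} (hc : c ∈ D.crossings) (hc' : c' ∈ D.crossings) {x y : Plane}
    (h : D.chart c x = D.chart c' y) : c = c' := by
  by_contra hne
  exact Set.disjoint_left.1 (D.disjoint_charts c hc c' hc' hne) ⟨x, rfl⟩ ⟨y, h.symm⟩

theorem chart_mem_image {c c' : F} (hc : c ∈ D.crossings) (hc' : c' ∈ D.crossings) {x : Plane}
    {s : Set Plane} : D.chart c x ∈ D.chart c' '' s ↔ c = c' ∧ x ∈ s := by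
  constructor
  · rintro ⟨y, hy, h⟩
    obtain rfl := eq_of_chart_eq hc' hc h
    obtain rfl := (D.isOpenDisc_chart _ hc).injective h
    exact ⟨rfl, hy⟩
  · rintro ⟨rfl, hx⟩
    exact ⟨x, hx, rfl⟩

theorem mem_carrier_chart {c : F} (hc : c ∈ D.crossings) {x : Plane} :
    D.chart c x ∈ D.carrier ↔ x ∈ crossModel := by
  rw [← D.preimage_chart c hc]; rfl

theorem smoothCarrier_chart_of_mem {T I : Finset F} {c : F} (hc : c ∈ D.crossings) (hT : c ∈ T)
    (x : Plane) : D.chart c x ∈ D.smoothCarrier T I ↔ x ∈ smoothModel (c ∈ I) := by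
  constructor
  · rintro (⟨h1, h2⟩ | ⟨c', hc', -, h⟩)
    · have h3 : x ∉ core := fun h => h2 c hc hT ⟨x, h, rfl⟩
      exact (smoothModel_iff _ h3).2 ((mem_carrier_chart hc).1 h1)
    · obtain ⟨rfl, h, -⟩ := (chart_mem_image hc hc').1 h
      exact h
  · intro hx
    by_cases h : x ∈ core
    · exact Or.inr ⟨c, hc, hT, x, ⟨hx, h⟩, rfl⟩
    · refine Or.inl ⟨(mem_carrier_chart hc).2 ((smoothModel_iff _ h).1 hx), fun c' hc' _ h' => ?_⟩
      exact h ((chart_mem_image hc hc').1 h').2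

theorem smoothCarrier_chart_of_not_mem {T I : Finset F} {c : F} (hc : c ∈ D.crossings)
    (hT : c ∉ T) (x : Plane) : D.chart c x ∈ D.smoothCarrier T I ↔ x ∈ crossModel := by
  rw [← mem_carrier_chart hc]
  constructor
  · rintro (⟨h1, -⟩ | ⟨c', hc', hT', h⟩)
    · exact h1
    · exact absurd (((chart_mem_image hc hc').1 h).1 ▸ hT') hT
  · intro hx
    exact Or.inl ⟨hx, fun c' hc' hT' h => hT (((chart_mem_image hc hc').1 h).1 ▸ hT')⟩

theorem smoothCarrier_of_forall {T I : Finset F} {p : F}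
    (hp : ∀ c ∈ D.crossings, c ∈ T → p ∉ D.chart c '' core) :
    p ∈ D.smoothCarrier T I ↔ p ∈ D.carrier := by
  constructor
  · rintro (⟨h1, -⟩ | ⟨c', hc', hT', x, hx, h⟩)
    · exact h1
    · exact absurd ⟨x, hx.2, h⟩ (hp c' hc' hT')
  · exact fun h => Or.inl ⟨h, hp⟩

theorem smoothCarrier_eventually [T2Space F] (T I : Finset F) {p : F}
    (hp : ∀ c ∈ D.crossings, c ∈ T → p ∉ D.chart c '' core) :
    ∀ᶠ q in 𝓝 p, (q ∈ D.carrier ↔ q ∈ D.smoothCarrier T I) := by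
  have h : ∀ᶠ q in 𝓝 p, ∀ c ∈ D.crossings, c ∈ T → q ∉ D.chart c '' core := by
    rw [Filter.eventually_all_finset]
    intro c hc
    by_cases hT : c ∈ T
    · have : IsClosed (D.chart c '' core) :=
        (isCompact_core.image (D.isOpenDisc_chart c hc).continuous).isClosed
      filter_upwards [this.isOpen_compl.mem_nhds (hp c hc hT)] with q hq _ using hq
    · exact Filter.Eventually.of_forall fun q h => absurd h hT
  filter_upwards [h] with q hq using (smoothCarrier_of_forall hq).symm

theorem isClosed_smoothCarrier [T2Space F] (T I : Finset F) : IsClosed (D.smoothCarrier T I) := by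
  rw [← isOpen_compl_iff, isOpen_iff_mem_nhds]
  intro p hp
  by_cases h : ∀ c ∈ D.crossings, c ∈ T → p ∉ D.chart c '' core
  · have hp' : p ∉ D.carrier := fun h' => hp ((smoothCarrier_of_forall h).2 h')
    filter_upwards [smoothCarrier_eventually T I h, D.isClosed.isOpen_compl.mem_nhds hp']
      with q h1 h2 h3 using h2 (h1.2 h3)
  · push Not at h
    obtain ⟨c, hc, hT, x, -, rfl⟩ := h
    have hx : x ∈ (smoothModel (c ∈ I))ᶜ := fun h' =>
      hp ((smoothCarrier_chart_of_mem hc hT x).2 h')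
    have ho := (D.isOpenDisc_chart c hc).isLocalDiffeomorph.isOpenMap _
      (isClosed_smoothModel (c ∈ I)).isOpen_compl
    filter_upwards [ho.mem_nhds ⟨x, hx, rfl⟩]
    rintro _ ⟨y, hy, rfl⟩ h'
    exact hy ((smoothCarrier_chart_of_mem hc hT y).1 h')

variable [OrientedSurface F]

variable (D)

open Classical in
/-- The diagram `D(σ)`, with marked crossings `C ∖ T`, which results from `D` by smoothing the
crossings in `T` according to the state `σ : T → {0, ∞}` with `σ⁻¹(∞) = I`. -/
def smooth (T I : Finset F) : Diagram β where
  carrier := D.smoothCarrier T I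
  isClosed := isClosed_smoothCarrier T I
  crossings := D.crossings \ T
  chart := D.chart
  chart_zero c hc := D.chart_zero c (Finset.mem_sdiff.1 hc).1
  isOpenDisc_chart c hc := D.isOpenDisc_chart c (Finset.mem_sdiff.1 hc).1
  isPositive_chart c hc := D.isPositive_chart c (Finset.mem_sdiff.1 hc).1
  preimage_chart c hc := Set.ext fun x =>
    smoothCarrier_chart_of_not_mem (Finset.mem_sdiff.1 hc).1 (Finset.mem_sdiff.1 hc).2 x
  disjoint_charts c hc c' hc' :=
    D.disjoint_charts c (Finset.mem_sdiff.1 hc).1 c' (Finset.mem_sdiff.1 hc').1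
  isArcPoint p hp hc := by
    by_cases h : ∀ c ∈ D.crossings, c ∈ T → p ∉ D.chart c '' core
    · refine (D.isArcPoint p ((smoothCarrier_of_forall h).1 hp) fun hc' => ?_).congr
        (smoothCarrier_eventually T I h)
      by_cases hT : p ∈ T
      · exact h p hc' hT ⟨0, zero_mem_core, D.chart_zero p hc'⟩
      · exact hc (Finset.mem_sdiff.2 ⟨hc', hT⟩)
    · push Not at h
      obtain ⟨c, hc', hT, x, -, rfl⟩ := h
      exact isArcPoint_of_model (D.isOpenDisc_chart c hc') (c ∈ I)
        (smoothCarrier_chart_of_mem hc' hT) ((smoothCarrier_chart_of_mem hc' hT x).1 hp)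
  boundary_pattern := by
    obtain ⟨j, hj⟩ := D.boundary_pattern
    refine ⟨j, fun i => ?_⟩
    rw [← hj i]
    ext p
    refine and_congr_left fun hp => smoothCarrier_of_forall fun c hc _ => ?_
    rintro ⟨x, -, rfl⟩
    refine (D.isOpenDisc_chart c hc).not_mem_boundary x ?_
    rw [← β.range_eq]
    exact Set.mem_iUnion.2 ⟨i, hp⟩
  marked := D.marked \ T
  marked_subset := Finset.sdiff_subset_sdiff D.marked_subset (Finset.Subset.refl _)

variable {D}

theorem Isotopic.smooth {D D' : Diagram β} (φ : F ≃ₘ^∞⟮𝓡∂ 2, 𝓡∂ 2⟯ F) (hφ : IsotopicToId φ)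
    (h1 : φ '' D.carrier = D'.carrier)
    (h2 : D.crossings.map φ.toEquiv.toEmbedding = D'.crossings)
    (h3 : D.marked.map φ.toEquiv.toEmbedding = D'.marked)
    (h4 : ∀ c ∈ D.crossings, (∀ x ∈ core, φ (D.chart c x) = D'.chart (φ c) x) ∨
      (∀ x ∈ core, φ (D.chart c x) = D'.chart (φ c) (-x))) (T I : Finset F) :
    (D.smooth T I).Isotopic
      (D'.smooth (T.map φ.toEquiv.toEmbedding) (I.map φ.toEquiv.toEmbedding)) := by
  classical
  have hsurj : Function.Surjective (φ : F → F) := φ.surjective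
  have hinj : Function.Injective (φ : F → F) := φ.injective
  have hmem : ∀ (s : Finset F) (c : F), φ c ∈ s.map φ.toEquiv.toEmbedding ↔ c ∈ s :=
    fun s c => Finset.mem_map' φ.toEquiv.toEmbedding
  have hc' : ∀ c, φ c ∈ D'.crossings ↔ c ∈ D.crossings := fun c => by rw [← h2, hmem]
  have himg : ∀ c ∈ D.crossings, ∀ s : Set Plane, (∀ x, -x ∈ s ↔ x ∈ s) → s ⊆ core → ∀ p,
      φ p ∈ D'.chart (φ c) '' s ↔ p ∈ D.chart c '' s := by
    intro c hc s hs hsc p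
    rcases h4 c hc with h | h
    · constructor
      · rintro ⟨x, hx, hxp⟩
        rw [← h x (hsc hx)] at hxp
        exact ⟨x, hx, φ.injective hxp⟩
      · rintro ⟨x, hx, rfl⟩
        exact ⟨x, hx, (h x (hsc hx)).symm⟩
    · constructor
      · rintro ⟨x, hx, hxp⟩
        have := h (-x) (hsc ((hs x).2 hx))
        rw [neg_neg, hxp] at this
        exact ⟨-x, (hs x).2 hx, φ.injective this⟩
      · rintro ⟨x, hx, rfl⟩
        exact ⟨-x, (hs x).2 hx, (h x (hsc hx)).symm⟩
  refine ⟨φ, hφ, ?_, ?_, ?_, fun c hc => h4 c (Finset.mem_sdiff.1 hc).1⟩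
  · ext q
    obtain ⟨p, rfl⟩ := hsurj q
    rw [hinj.mem_set_image]
    refine or_congr (and_congr ?_ ?_) ?_
    · rw [← h1, hinj.mem_set_image]
    · refine Iff.symm ?_
      rw [hsurj.forall]
      refine forall_congr' fun c => ?_
      rw [hc', hmem]
      refine forall_congr' fun hc => ?_
      exact forall_congr' fun _ => (himg c hc core (fun _ => neg_mem_core) le_rfl p).not
    · simp only [Set.mem_ofPred_eq]
      refine Iff.symm ?_
      rw [hsurj.exists]
      refine exists_congr fun c => ?_
      rw [hc', hmem]
      refine and_congr_right fun hc => ?_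
      have := himg c hc (smoothModel (c ∈ I) ∩ core)
        (fun x => and_congr (neg_mem_smoothModel _) neg_mem_core) Set.inter_subset_right p
      rw [← this]
      simp only [hmem]
  · change (D.crossings \ T).map _ = D'.crossings \ _
    rw [Finset.map_sdiff, h2]
  · change (D.marked \ T).map _ = D'.marked \ _
    rw [Finset.map_sdiff, h3]

end Diagram

end Smoothing

end KauffmanExpansion

namespace KauffmanExpansion

section TrivialComponents

variable {F : Type*} [TopologicalSpace F] [ChartedSpace HalfPlane F]

theorem IsArcPoint.eventually_mem_component {A : Set F} {p : F} (h : IsArcPoint A p)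
    (hp : p ∈ A) : ∀ᶠ q in 𝓝 p, q ∈ A → q ∈ connectedComponentIn A p := by
  rcases h with ⟨e, he, rfl, h⟩ | ⟨e, he, rfl, h⟩
  · obtain ⟨Φ, h0, hΦ⟩ := id he
    have hs : Φ.source ∈ 𝓝 (0 : Plane) := Φ.open_source.mem_nhds h0
    obtain ⟨ε, hε, hb⟩ := Metric.mem_nhds_iff.1 (Filter.inter_mem h hs)
    have hcont : ContinuousOn e (Metric.ball 0 ε) :=
      (Φ.contMDiffOn_toFun.continuousOn.congr hΦ).mono fun x hx => (hb hx).2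
    have hopen : e '' Metric.ball 0 ε ∈ 𝓝 (e 0) := by
      have := (Φ.toOpenPartialHomeomorph.isOpen_image_of_subset_source (Metric.isOpen_ball)
        (fun x hx => (hb hx).2 : Metric.ball (0 : Plane) ε ⊆ Φ.source)).mem_nhds
          ⟨0, Metric.mem_ball_self hε, (hΦ h0).symm⟩
      refine Filter.mem_of_superset this ?_
      rintro _ ⟨x, hx, rfl⟩
      exact ⟨x, hx, hΦ (hb hx).2⟩
    filter_upwards [hopen]
    rintro _ ⟨x, hx, rfl⟩ hxA
    have hconv : Convex ℝ (Metric.ball (0 : Plane) ε ∩ {x | x 1 = 0}) := by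
      refine (convex_ball _ _).inter ?_
      intro y hy z hz a b _ _ _
      have hy : y 1 = 0 := hy
      have hz : z 1 = 0 := hz
      change (a • y + b • z) 1 = 0
      simp [hy, hz]
    have hpre := hconv.isPreconnected.image e (hcont.mono Set.inter_subset_left)
    refine hpre.subset_connectedComponentIn ⟨0, ⟨Metric.mem_ball_self hε, rfl⟩, rfl⟩ ?_
      ⟨x, ⟨hx, ((hb hx).1).1 hxA⟩, rfl⟩
    rintro _ ⟨y, hy, rfl⟩
    exact ((hb hy.1).1).2 hy.2
  · obtain ⟨Φ, h0, hΦ⟩ := id he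
    have hs : Φ.source ∈ 𝓝 (0 : HalfPlane) := Φ.open_source.mem_nhds h0
    obtain ⟨U, hU, hb⟩ := (mem_nhds_subtype _ _ _).1 (Filter.inter_mem h hs)
    obtain ⟨ε, hε, hbU⟩ := Metric.mem_nhds_iff.1 hU
    set B : Set HalfPlane := Subtype.val ⁻¹' Metric.ball (0 : Plane) ε with hB
    have hb : ∀ x ∈ B, (e x ∈ A ↔ x.1 1 = 0) ∧ x ∈ Φ.source := fun x hx => hb (hbU hx)
    have h0B : (0 : HalfPlane) ∈ B := Metric.mem_ball_self hε
    have hBo : IsOpen B := Metric.isOpen_ball.preimage continuous_subtype_val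
    have hcont : ContinuousOn e B :=
      (Φ.contMDiffOn_toFun.continuousOn.congr hΦ).mono fun x hx => (hb x hx).2
    have hopen : e '' B ∈ 𝓝 (e 0) := by
      have := (Φ.toOpenPartialHomeomorph.isOpen_image_of_subset_source hBo
        (fun x hx => (hb x hx).2 : B ⊆ Φ.source)).mem_nhds ⟨0, h0B, (hΦ h0).symm⟩
      refine Filter.mem_of_superset this ?_
      rintro _ ⟨x, hx, rfl⟩
      exact ⟨x, hx, hΦ (hb x hx).2⟩
    filter_upwards [hopen]
    rintro _ ⟨x, hx, rfl⟩ hxA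
    have hpre0 : IsPreconnected (B ∩ {x | x.1 1 = 0}) := by
      have hind : Topology.IsInducing (Subtype.val : HalfPlane → Plane) := ⟨rfl⟩
      refine hind.isPreconnected_image.1 ?_
      have : Subtype.val '' (B ∩ {x : HalfPlane | x.1 1 = 0}) =
          Metric.ball (0 : Plane) ε ∩ {x | 0 ≤ x 0 ∧ x 1 = 0} := by
        ext y
        constructor
        · rintro ⟨z, ⟨h1, h2⟩, rfl⟩
          exact ⟨h1, z.2, h2⟩
        · rintro ⟨h1, h2, h3⟩
          exact ⟨⟨y, h2⟩, ⟨h1, h3⟩, rfl⟩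
      rw [this]
      refine Convex.isPreconnected ((convex_ball _ _).inter ?_)
      rintro y ⟨hy0, hy⟩ z ⟨hz0, hz⟩ a b ha hb _
      change 0 ≤ (a • y + b • z) 0 ∧ (a • y + b • z) 1 = 0
      simp only [PiLp.add_apply, PiLp.smul_apply, smul_eq_mul, hy, hz]
      exact ⟨by positivity, by ring⟩
    have hpre := hpre0.image e (hcont.mono Set.inter_subset_left)
    refine hpre.subset_connectedComponentIn ⟨0, ⟨h0B, rfl⟩, rfl⟩ ?_
      ⟨x, ⟨hx, ((hb x hx).1).1 hxA⟩, rfl⟩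
    rintro _ ⟨y, hy, rfl⟩
    exact ((hb y hy.1).1).2 hy.2

theorem IsOpenDisc.comp_diffeomorph {e : Plane → F} (he : IsOpenDisc e)
    (φ : F ≃ₘ^∞⟮𝓡∂ 2, 𝓡∂ 2⟯ F) : IsOpenDisc (φ ∘ e) :=
  ⟨φ.injective.comp he.injective,
    fun x => (he.isLocalDiffeomorph x).comp _ _ (φ.isLocalDiffeomorph _)⟩

namespace Diagram

variable {r : ℕ} {β : BoundaryParametrization F r} (D : Diagram β)

/-- `K` is a trivial (inessential) component of the diagram: a component without crossings which
is the boundary circle of an embedded disc in `F`. -/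
structure IsTrivialComponent (K : Set F) : Prop where
  isComponent : ∃ p ∈ D.carrier, K = connectedComponentIn D.carrier p
  no_crossing : ∀ c ∈ D.crossings, c ∉ K
  bounds_disc : ∃ e : Plane → F, IsOpenDisc e ∧ K = e '' Metric.sphere 0 1

/-- The number of trivial components. -/
def trivialCount : ℕ := {K | D.IsTrivialComponent K}.ncard

/-- The union of all components which are not trivial. -/
def discardCarrier : Set F := {p | p ∈ D.carrier ∧ ∀ K, D.IsTrivialComponent K → p ∉ K}

variable {D}

theorem IsTrivialComponent.eq {K : Set F} (h : D.IsTrivialComponent K) {p : F} (hp : p ∈ K) :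
    K = connectedComponentIn D.carrier p := by
  obtain ⟨q, hq, rfl⟩ := h.isComponent
  exact connectedComponentIn_eq hp

theorem chart_mem_component {c : F} (hc : c ∈ D.crossings) {x : Plane} (hx : x ∈ crossModel) :
    D.chart c x ∈ connectedComponentIn D.carrier c := by
  have h := isPreconnected_crossModel.image (D.chart c)
    (D.isOpenDisc_chart c hc).continuous.continuousOn
  refine h.subset_connectedComponentIn ⟨0, zero_mem_crossModel, D.chart_zero c hc⟩ ?_ ⟨x, hx, rfl⟩
  rintro _ ⟨y, hy, rfl⟩
  exact (mem_carrier_chart hc).2 hy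

theorem crossing_mem {c : F} (hc : c ∈ D.crossings) : c ∈ D.carrier := by
  rw [← D.chart_zero c hc]
  exact (mem_carrier_chart hc).2 zero_mem_crossModel

theorem eventually_mem_component {p : F} (hp : p ∈ D.carrier) :
    ∀ᶠ q in 𝓝 p, q ∈ D.carrier → q ∈ connectedComponentIn D.carrier p := by
  by_cases hc : p ∈ D.crossings
  · filter_upwards [(D.isOpenDisc_chart p hc).isOpen_range.mem_nhds ⟨0, D.chart_zero p hc⟩]
    rintro _ ⟨x, rfl⟩ hx
    exact chart_mem_component hc ((mem_carrier_chart hc).1 hx)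
  · exact (D.isArcPoint p hp hc).eventually_mem_component hp

theorem mem_discardCarrier_of_component {p q : F} (hp : p ∈ D.discardCarrier)
    (hq : q ∈ connectedComponentIn D.carrier p) : q ∈ D.discardCarrier := by
  refine ⟨connectedComponentIn_subset _ _ hq, fun K hK hqK => hp.2 K hK ?_⟩
  rw [hK.eq hqK, ← connectedComponentIn_eq hq]
  exact mem_connectedComponentIn hp.1

theorem discardCarrier_eventually {p : F} (hp : p ∈ D.discardCarrier) :
    ∀ᶠ q in 𝓝 p, (q ∈ D.carrier ↔ q ∈ D.discardCarrier) := by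
  filter_upwards [eventually_mem_component hp.1] with q hq
  exact ⟨fun h => mem_discardCarrier_of_component hp (hq h), fun h => h.1⟩

theorem isClosed_discardCarrier : IsClosed D.discardCarrier := by
  rw [← isOpen_compl_iff, isOpen_iff_mem_nhds]
  intro p hp
  by_cases h : p ∈ D.carrier
  · have : ∃ K, D.IsTrivialComponent K ∧ p ∈ K := by
      by_contra! h'
      exact hp ⟨h, h'⟩
    obtain ⟨K, hK, hpK⟩ := this
    filter_upwards [eventually_mem_component h] with q hq hq'
    refine hq'.2 K hK ?_
    rw [hK.eq hpK]
    exact hq hq'.1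
  · filter_upwards [D.isClosed.isOpen_compl.mem_nhds h] with q hq hq' using hq hq'.1

theorem crossing_mem_discardCarrier {c : F} (hc : c ∈ D.crossings) : c ∈ D.discardCarrier :=
  ⟨crossing_mem hc, fun _ hK => hK.no_crossing c hc⟩

theorem component_discardCarrier {p : F} (hp : p ∈ D.discardCarrier) :
    connectedComponentIn D.discardCarrier p = connectedComponentIn D.carrier p := by
  refine (connectedComponentIn_mono p fun q hq => hq.1).antisymm ?_
  exact isPreconnected_connectedComponentIn.subset_connectedComponentIn
    (mem_connectedComponentIn hp.1) fun q hq => mem_discardCarrier_of_component hp hq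

theorem IsTrivialComponent.map {D D' : Diagram β} (φ : F ≃ₘ^∞⟮𝓡∂ 2, 𝓡∂ 2⟯ F)
    (h1 : φ '' D.carrier = D'.carrier)
    (h2 : D.crossings.map φ.toEquiv.toEmbedding = D'.crossings) {K : Set F}
    (h : D.IsTrivialComponent K) : D'.IsTrivialComponent (φ '' K) := by
  refine ⟨?_, ?_, ?_⟩
  · obtain ⟨p, hp, rfl⟩ := h.isComponent
    refine ⟨φ p, h1 ▸ ⟨p, hp, rfl⟩, ?_⟩
    rw [← h1]
    exact φ.toHomeomorph.image_connectedComponentIn hp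
  · rw [← h2]
    intro c hc hcK
    obtain ⟨c, hc', rfl⟩ := Finset.mem_map.1 hc
    obtain ⟨d, hd, hdc⟩ := hcK
    obtain rfl := φ.injective hdc
    exact h.no_crossing _ hc' hd
  · obtain ⟨e, he, rfl⟩ := h.bounds_disc
    exact ⟨φ ∘ e, he.comp_diffeomorph φ, by rw [Set.image_comp]⟩

variable (D) [OrientedSurface F]

/-- The diagram which results from `D` by discarding all trivial components. -/
def discard : Diagram β where
  carrier := D.discardCarrier
  isClosed := isClosed_discardCarrier
  crossings := D.crossings
  chart := D.chart
  chart_zero := D.chart_zero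
  isOpenDisc_chart := D.isOpenDisc_chart
  isPositive_chart := D.isPositive_chart
  preimage_chart c hc := by
    ext x
    rw [← mem_carrier_chart hc]
    refine ⟨fun h => h.1, fun h => ?_⟩
    exact mem_discardCarrier_of_component (crossing_mem_discardCarrier hc)
      (chart_mem_component hc ((mem_carrier_chart hc).1 h))
  disjoint_charts := D.disjoint_charts
  isArcPoint p hp hc := (D.isArcPoint p hp.1 hc).congr (discardCarrier_eventually hp)
  boundary_pattern := by
    obtain ⟨j, hj⟩ := D.boundary_pattern
    refine ⟨j, fun i => ?_⟩
    rw [← hj i]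
    ext p
    refine and_congr_left fun hp => ⟨fun h => h.1, fun h => ⟨h, fun K hK hpK => ?_⟩⟩
    obtain ⟨e, he, rfl⟩ := hK.bounds_disc
    obtain ⟨x, -, rfl⟩ := hpK
    refine he.not_mem_boundary x ?_
    rw [← β.range_eq]
    exact Set.mem_iUnion.2 ⟨i, hp⟩
  marked := D.marked
  marked_subset := D.marked_subset

/-- A curve system: a diagram without crossings and without trivial components. -/
def IsCurveSystem : Prop := D.crossings = ∅ ∧ ∀ K, ¬ D.IsTrivialComponent K

variable {D}

theorem isCurveSystem_discard (h : D.crossings = ∅) : D.discard.IsCurveSystem := by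
  refine ⟨h, fun K hK => ?_⟩
  obtain ⟨p, hp, hK'⟩ := hK.isComponent
  have hp' : p ∈ D.discardCarrier := hp
  have hK'' : K = connectedComponentIn D.carrier p := hK'.trans (component_discardCarrier hp')
  refine hp'.2 K ⟨⟨p, hp'.1, hK''⟩, hK.no_crossing, hK.bounds_disc⟩ ?_
  rw [hK'']
  exact mem_connectedComponentIn hp'.1

end Diagram

end TrivialComponents

end KauffmanExpansion

namespace KauffmanExpansion

section Classes

variable {F : Type*} [TopologicalSpace F] [ChartedSpace HalfPlane F] {r : ℕ}

namespace Diagram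

variable {β : BoundaryParametrization F r}

theorem trivialCount_eq_of_isotopic {D D' : Diagram β} (h : D.Isotopic D') :
    D.trivialCount = D'.trivialCount := by
  obtain ⟨φ, -, h1, h2, -, -⟩ := id h
  obtain ⟨ψ, -, k1, k2, -, -⟩ := h.symm
  have hφ : Function.Injective (φ : F → F) := φ.injective
  have key : {K | D'.IsTrivialComponent K} = (fun K => φ '' K) '' {K | D.IsTrivialComponent K} := by
    ext K
    constructor
    · intro hK
      refine ⟨φ.symm '' K, ?_, ?_⟩
      · refine IsTrivialComponent.map φ.symm ?_ ?_ hK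
        · rw [← h1, Set.image_image]; simp
        · rw [← h2, Finset.map_map]
          convert Finset.map_refl
          ext x; exact φ.symm_apply_apply x
      · simp [Set.image_image]
    · rintro ⟨K, hK, rfl⟩
      exact hK.map φ h1 h2
  unfold trivialCount
  rw [key]
  exact (Set.ncard_image_of_injective _ hφ.image_injective).symm

theorem Isotopic.card_crossings {D D' : Diagram β} (h : D.Isotopic D') :
    D.crossings.card = D'.crossings.card := by
  obtain ⟨φ, -, -, h2, -, -⟩ := h
  rw [← h2, Finset.card_map]

variable [OrientedSurface F]

theorem Isotopic.discard {D D' : Diagram β} (h : D.Isotopic D') :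
    D.discard.Isotopic D'.discard := by
  obtain ⟨φ, hφ, h1, h2, h3, h4⟩ := id h
  have hinj : Function.Injective (φ : F → F) := φ.injective
  refine ⟨φ, hφ, ?_, h2, h3, h4⟩
  ext q
  have hsurj : Function.Surjective (φ : F → F) := φ.surjective
  obtain ⟨p, rfl⟩ := hsurj q
  rw [hinj.mem_set_image]
  refine and_congr (by rw [← h1, hinj.mem_set_image]) ⟨fun hp K hK hpK => ?_, fun hp K hK hpK => ?_⟩
  · refine hp (φ.symm '' K) ?_ ⟨φ p, hpK, φ.symm_apply_apply p⟩
    refine IsTrivialComponent.map φ.symm ?_ ?_ hK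
    · rw [← h1, Set.image_image]; simp
    · rw [← h2, Finset.map_map]
      convert Finset.map_refl
      ext x; exact φ.symm_apply_apply x
  · exact hp _ (hK.map φ h1 h2) ⟨p, hpK, rfl⟩

end Diagram

variable [OrientedSurface F]

/-- The set `𝒟(F)` of isotopy classes `[D, C]` of diagrams. -/
abbrev DiagramClass (β : BoundaryParametrization F r) : Type _ := Quotient (Diagram.setoid β)

/-- The set `𝔇ᵃ(F)` of (isotopy classes of) real diagrams. -/
def realDiagrams (β : BoundaryParametrization F r) : Set (DiagramClass β) :=
  {x | ∃ D : Diagram β, D.IsReal ∧ Quotient.mk _ D = x}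

/-- The set `ℭᵃ(F)` of isotopy classes of curve systems. -/
def CurveSystem (β : BoundaryParametrization F r) : Type _ :=
  {x : DiagramClass β // ∃ D : Diagram β, D.IsCurveSystem ∧ Quotient.mk _ D = x}

variable {β : BoundaryParametrization F r}

/-- The diagram which results from smoothing all crossings of `D` according to the Kauffman state
with `∞`-markers at `I`. -/
def Diagram.resolve (D : Diagram β) (I : Finset F) : Diagram β := D.smooth D.crossings I

open Classical in
/-- The curve system `D(σ)` of a Kauffman state `σ` of `D` with `σ⁻¹(∞) = I`: all crossings are
smoothed according to `σ` and trivial components are discarded. -/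
def Diagram.stateCurves (D : Diagram β) (I : Finset F) : CurveSystem β :=
  ⟨Quotient.mk _ (D.resolve I).discard, _,
    Diagram.isCurveSystem_discard (Finset.sdiff_self _), rfl⟩

/-- The number `μ(σ)` of trivial components of the smoothing of `D` by the Kauffman state `σ` with
`σ⁻¹(∞) = I`. -/
def Diagram.mu (D : Diagram β) (I : Finset F) : ℕ := (D.resolve I).trivialCount

section Operators

variable {R : Type*} [CommRing R]

/-- `∑ 𝔭(ι(σ)) [D(σ), C(σ)]`, up to the sign `(-1)ᵏ`: the sum is over all `k`-states `σ` on `C`, a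
`k`-state being a `k`-element subset `T` of `C` and a map `σ : T → {0, ∞}`, here given by
`I = σ⁻¹(∞) ⊆ T`, and `ι(σ) = |I|`. -/
def Diagram.chi (k : ℕ) (p : ℕ → R) (D : Diagram β) : DiagramClass β →₀ R :=
  (-1 : R) ^ k • ∑ T ∈ D.marked.powersetCard k, ∑ I ∈ T.powerset,
    Finsupp.single (Quotient.mk _ (D.smooth T I)) (p I.card)

/-- `(-1)^c ∑ φ(μ(σ)) D(σ)`, where the sum is over all Kauffman states `σ` of `D` and `c` is the
number of crossings. -/
def Diagram.projection (φ : ℕ → R) (D : Diagram β) : CurveSystem β →₀ R :=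
  (-1 : R) ^ D.crossings.card • ∑ I ∈ D.crossings.powerset,
    Finsupp.single (D.stateCurves I) (φ (D.mu I))

open LaurentPolynomial in
/-- The Kauffman bracket
`⟨D⟩ = ∑ (-t)^(ζ(σ) - ι(σ)) (-t² - t⁻²)^μ(σ) D(σ) ∈ R[t, t⁻¹] ℭᵃ(F)`,
where the sum is over all Kauffman states `σ` of `D`, here given by `I = σ⁻¹(∞)`, and `ζ(σ)`, `ι(σ)`
are the numbers of `0`- and `∞`-markers. -/
def Diagram.bracket (R : Type*) [CommRing R] (D : Diagram β) : CurveSystem β →₀ R[T;T⁻¹] :=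
  ∑ I ∈ D.crossings.powerset, Finsupp.single (D.stateCurves I)
    ((-T 1) ^ (D.crossings.card - I.card) * (-T (-1)) ^ I.card * (-T 2 - T (-2)) ^ D.mu I)

theorem Diagram.sum_powerset_congr {M : Type*} [AddCommMonoid M] {D D' : Diagram β}
    (h : D.Isotopic D') (f f' : Finset F → M)
    (hf : ∀ φ : F ≃ F, D.crossings.map φ.toEmbedding = D'.crossings →
      (∀ T I : Finset F, (D.smooth T I).Isotopic
        (D'.smooth (T.map φ.toEmbedding) (I.map φ.toEmbedding))) →
      ∀ I ∈ D.crossings.powerset, f I = f' (I.map φ.toEmbedding)) :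
    ∑ I ∈ D.crossings.powerset, f I = ∑ I ∈ D'.crossings.powerset, f' I := by
  obtain ⟨φ, hφ, h1, h2, h3, h4⟩ := h
  rw [← h2]
  have : (D.crossings.map φ.toEquiv.toEmbedding).powerset =
      D.crossings.powerset.map (Finset.mapEmbedding φ.toEquiv.toEmbedding).toEmbedding := by
    ext I; simp [Finset.subset_map_iff, eq_comm]
  rw [this, Finset.sum_map]
  exact Finset.sum_congr rfl
    (hf φ.toEquiv h2 (Diagram.Isotopic.smooth φ hφ h1 h2 h3 h4))

theorem Diagram.stateCurves_congr {D D' : Diagram β} {φ : F ≃ F}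
    (h2 : D.crossings.map φ.toEmbedding = D'.crossings)
    (hs : ∀ T I : Finset F, (D.smooth T I).Isotopic
      (D'.smooth (T.map φ.toEmbedding) (I.map φ.toEmbedding))) (I : Finset F) :
    D.stateCurves I = D'.stateCurves (I.map φ.toEmbedding) ∧
      D.mu I = D'.mu (I.map φ.toEmbedding) := by
  have h := hs D.crossings I
  rw [h2] at h
  exact ⟨Subtype.ext (Quotient.sound h.discard), trivialCount_eq_of_isotopic h⟩

theorem Diagram.projection_congr (φ : ℕ → R) {D D' : Diagram β} (h : D.Isotopic D') :
    D.projection φ = D'.projection φ := by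
  unfold Diagram.projection
  rw [h.card_crossings]
  congr 1
  refine sum_powerset_congr h _ _ fun ψ h2 hs I _ => ?_
  obtain ⟨h3, h4⟩ := stateCurves_congr h2 hs I
  rw [h3, h4]

theorem Diagram.bracket_congr {D D' : Diagram β} (h : D.Isotopic D') :
    D.bracket R = D'.bracket R := by
  unfold Diagram.bracket
  rw [h.card_crossings]
  refine sum_powerset_congr h _ _ fun ψ h2 hs I _ => ?_
  obtain ⟨h3, h4⟩ := stateCurves_congr h2 hs I
  rw [h3, h4, Finset.card_map]

theorem Diagram.chi_congr (k : ℕ) (p : ℕ → R) {D D' : Diagram β} (h : D.Isotopic D') :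
    D.chi k p = D'.chi k p := by
  obtain ⟨φ, hφ, h1, h2, h3, h4⟩ := h
  have hs := Diagram.Isotopic.smooth φ hφ h1 h2 h3 h4
  unfold Diagram.chi
  rw [← h3, Finset.powersetCard_map, Finset.sum_map]
  congr 1
  refine Finset.sum_congr rfl fun T _ => ?_
  change _ = ∑ I ∈ (T.map φ.toEquiv.toEmbedding).powerset, _
  have : (T.map φ.toEquiv.toEmbedding).powerset =
      T.powerset.map (Finset.mapEmbedding φ.toEquiv.toEmbedding).toEmbedding := by
    ext I; simp [Finset.subset_map_iff, eq_comm]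
  rw [this, Finset.sum_map]
  refine Finset.sum_congr rfl fun I _ => ?_
  change _ = Finsupp.single (Quotient.mk _ (D'.smooth _ (I.map φ.toEquiv.toEmbedding)))
    (p (I.map φ.toEquiv.toEmbedding).card)
  rw [Finset.card_map]
  congr 1
  exact Quotient.sound (hs T I)

/-- The endomorphism `χ_k(p)` of `R 𝒟(F)`; the function `p : ℕ → R` is the sequence of coefficients
of a polynomial in `z` of degree at most `k`. -/
def chiDegree (β : BoundaryParametrization F r) (k : ℕ) (p : ℕ → R) :
    Module.End R (DiagramClass β →₀ R) :=
  Finsupp.linearCombination R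
    (Quotient.lift (Diagram.chi k p) fun _ _ h => Diagram.chi_congr k p h)

open MvPolynomial in
/-- The algebra homomorphism `𝔠` of `R[z, w]` with `z ↦ z w` and `w ↦ w`. Here `z = X 0` and
`w = X 1`. -/
def substZW : MvPolynomial (Fin 2) R →ₐ[R] MvPolynomial (Fin 2) R := aeval ![X 0 * X 1, X 1]

/-- The coefficients of `π_k(Q) ∈ R[z]`, the coefficient of `w ^ k` in `Q ∈ R[z][w]`. -/
def coeffW (k : ℕ) (Q : MvPolynomial (Fin 2) R) (i : ℕ) : R :=
  Q.coeff (Finsupp.single 0 i + Finsupp.single 1 k)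

/-- The endomorphism `χ(P) = ∑ₖ χ_k(π_k(𝔠(P)))` of `R 𝒟(F)`, for `P ∈ R[z, w]`. -/
def chi (β : BoundaryParametrization F r) (P : MvPolynomial (Fin 2) R) :
    Module.End R (DiagramClass β →₀ R) :=
  ∑ k ∈ Finset.range (P.totalDegree + 1), chiDegree β k (coeffW k (substZW P))

/-- The projection `φ_* : R 𝒟(F) → R ℭᵃ(F)` determined by a map `φ : ℕ → R`. -/
def pushforward (β : BoundaryParametrization F r) (φ : ℕ → R) :
    (DiagramClass β →₀ R) →ₗ[R] (CurveSystem β →₀ R) :=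
  Finsupp.linearCombination R
    (Quotient.lift (Diagram.projection φ) fun _ _ h => Diagram.projection_congr φ h)

open LaurentPolynomial in
/-- The Kauffman bracket of an isotopy class of diagrams. -/
def bracket (R : Type*) [CommRing R] : DiagramClass β → (CurveSystem β →₀ R[T;T⁻¹]) :=
  Quotient.lift (Diagram.bracket R) fun _ _ h => Diagram.bracket_congr h

end Operators

end Classes

section Expansion

variable (R : Type*) [CommRing R] [Algebra ℚ R]

/-- The unit `e^h` of `R⟦h⟧`, with inverse `e^(-h)`. -/
def expUnit : (PowerSeries R)ˣ where
  val := PowerSeries.exp R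
  inv := PowerSeries.evalNegHom (PowerSeries.exp R)
  val_inv := PowerSeries.exp_mul_exp_neg_eq_one
  inv_val := by rw [mul_comm]; exact PowerSeries.exp_mul_exp_neg_eq_one

open LaurentPolynomial in
/-- The homomorphism `R[t, t⁻¹] → R⟦h⟧` with `t ↦ e^h`. -/
def expSubst : R[T;T⁻¹] →+* PowerSeries R :=
  LaurentPolynomial.eval₂ PowerSeries.C (expUnit R)

/-- The coefficient `⟨D⟩ₙ ∈ R ℭᵃ(F)` of `hⁿ` in the Kauffman bracket, where `t = e^h`. -/
def bracketCoeff {F : Type*} [TopologicalSpace F] [ChartedSpace HalfPlane F] [OrientedSurface F]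
    {r : ℕ} {β : BoundaryParametrization F r} (n : ℕ) (D : DiagramClass β) : CurveSystem β →₀ R :=
  (bracket R D).mapRange (fun q => PowerSeries.coeff n (expSubst R q)) (by simp)

open LaurentPolynomial in
/-- `φ_j(i)` is the coefficient of `h ^ (2 j)` in `(-t² - t⁻²) ^ i`, where `t = e^h`. -/
def loopCoeff (j i : ℕ) : ℚ :=
  PowerSeries.coeff (2 * j) (expSubst ℚ ((-T 2 - T (-2)) ^ i))

end Expansion

end KauffmanExpansion

end

/-! Put t = e^h. A Kauffman state with ∞-markers at K has the weight (-1)^c (e^h)^ζ (e^(-h))^ι (-t²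
- t⁻²)^μ, where ζ + ι = c is the number of crossings, so the sign does not depend on the state.
Write e^h = 1 + (e^h - 1) at each 0-marker, e^(-h) = 1 + (e^(-h) - 1) at each ∞-marker, and multiply
out. The exponential part becomes a sum over all sets T of crossings of (e^(-h) - 1)^|T ∩ K| (e^h -
1)^|T ∖ K| (`coeff_exp_pow_mul_exp_neg_pow`). This dictates the polynomial: the coefficient of z^i
w^l in P_n is that of h^n in (e^(-h) - 1)^i (e^h - 1)^l. Only the cardinalities of T ∩ K and T ∖ K
enter, hence P_n depends neither on the surface nor on the ring.

On the other side, χ(P) smooths a set T with ∞-markers I ⊆ T, and φ_* then smooths the remaining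
crossings with ∞-markers J. Two-stage smoothing is the same as smoothing everything at once with K =
I ∪ J (`Diagram.resolve_smooth`), and (T, I, J) corresponds to (T, K) by I = K ∩ T, J = K ∖ T. The
signs (-1)^|T| and (-1)^(c - |T|) multiply to (-1)^c. So φ_* ∘ χ(P) is also a sum over Kauffman
states with inner sums over T (`pushforward_chi_single`), and the two sides agree state by state.
The loop factor is even in h, so its contributions are exactly the φ_j, with h^(n - 2j) left for the
exponential part (`coeff_mul_loop`).

The shape of P_n follows from (e^(-h) - 1)^i (e^h - 1)^l = (-1)^i h^(i+l) + higher terms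
(`exists_expansion_factor`). -/

noncomputable section

namespace KauffmanExpansion

/-! ### The polynomials -/

section Polynomials

open PowerSeries

/-- The coefficient of `h ^ n` in `(e^(-h) - 1) ^ i * (e^h - 1) ^ l`. -/
def expansionCoeff (n i l : ℕ) : ℚ :=
  coeff n ((evalNegHom (exp ℚ) - 1) ^ i * (exp ℚ - 1) ^ l)

/-- Both e^h - 1 and e^(-h) - 1 vanish to first order at h = 0, with linear coefficients 1 and -1.
The degree bound and the top homogeneous component of `expansionPoly` both rest on this. -/
theorem exists_expansion_factor (i l : ℕ) : ∃ u : PowerSeries ℚ, constantCoeff u = (-1) ^ i ∧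
    (evalNegHom (exp ℚ) - 1) ^ i * (exp ℚ - 1) ^ l = X ^ (i + l) * u := by
  obtain ⟨u, hu⟩ : X ∣ exp ℚ - 1 := X_dvd_iff.2 (by simp)
  obtain ⟨v, hv⟩ : X ∣ evalNegHom (exp ℚ) - 1 := X_dvd_iff.2 (by
    rw [← coeff_zero_eq_constantCoeff_apply, map_sub, evalNegHom, coeff_rescale]
    simp)
  have hu1 : constantCoeff u = 1 := by
    have := congrArg (coeff 1) hu
    simpa [coeff_exp, coeff_one, mul_comm (X : PowerSeries ℚ), coeff_succ_mul_X] using this.symm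
  have hv1 : constantCoeff v = -1 := by
    have := congrArg (coeff 1) hv
    simpa [evalNegHom, coeff_rescale, coeff_exp, coeff_one, mul_comm (X : PowerSeries ℚ),
      coeff_succ_mul_X] using this.symm
  refine ⟨v ^ i * u ^ l, by simp [hu1, hv1], ?_⟩
  rw [hu, hv]
  ring

theorem expansionCoeff_eq_zero {n i l : ℕ} (h : n < i + l) : expansionCoeff n i l = 0 := by
  obtain ⟨u, -, hu⟩ := exists_expansion_factor i l
  rw [expansionCoeff, hu, coeff_X_pow_mul', if_neg h.not_ge]

theorem expansionCoeff_self (i l : ℕ) : expansionCoeff (i + l) i l = (-1) ^ i := by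
  obtain ⟨u, h1, hu⟩ := exists_expansion_factor i l
  rw [expansionCoeff, hu, coeff_X_pow_mul', if_pos le_rfl, Nat.sub_self,
    coeff_zero_eq_constantCoeff_apply, h1]

/-- The polynomial whose coefficient of `z ^ i * w ^ l` is `expansionCoeff n i l`. -/
def expansionPoly (n : ℕ) : MvPolynomial (Fin 2) ℚ :=
  ∑ p ∈ Finset.range (n + 1) ×ˢ Finset.range (n + 1),
    MvPolynomial.monomial (Finsupp.single 0 p.1 + Finsupp.single 1 p.2) (expansionCoeff n p.1 p.2)

theorem finsupp_fin_two (d : Fin 2 →₀ ℕ) :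
    d = Finsupp.single 0 (d 0) + Finsupp.single 1 (d 1) := by
  ext i; fin_cases i <;> simp

theorem degree_single_add_single (i l : ℕ) :
    (Finsupp.single 0 i + Finsupp.single 1 l : Fin 2 →₀ ℕ).degree = i + l := by
  rw [map_add, Finsupp.degree_single, Finsupp.degree_single]

theorem sum_single_add_single (i l : ℕ) :
    (Finsupp.single 0 i + Finsupp.single 1 l : Fin 2 →₀ ℕ).sum (fun _ e => e) = i + l := by
  rw [Finsupp.sum_fintype _ _ (by simp)]
  simp

theorem single_add_single_inj {i l i' l' : ℕ} :
    (Finsupp.single 0 i + Finsupp.single 1 l : Fin 2 →₀ ℕ) =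
      Finsupp.single 0 i' + Finsupp.single 1 l' ↔ i = i' ∧ l = l' := by
  constructor
  · intro h
    have h0 := DFunLike.congr_fun h 0
    have h1 := DFunLike.congr_fun h 1
    simpa using And.intro h0 h1
  · rintro ⟨rfl, rfl⟩; rfl

theorem coeff_expansionPoly (n i l : ℕ) :
    (expansionPoly n).coeff (Finsupp.single 0 i + Finsupp.single 1 l) = expansionCoeff n i l := by
  rw [expansionPoly, MvPolynomial.coeff_sum, Finset.sum_eq_single (i, l)]
  · rw [MvPolynomial.coeff_monomial, if_pos rfl]
  · rintro ⟨i', l'⟩ - hne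
    rw [MvPolynomial.coeff_monomial, if_neg]
    rw [single_add_single_inj]
    rintro ⟨rfl, rfl⟩
    exact hne rfl
  -- The square of indices contains the triangle i + l ≤ n. An index outside the square has i > n or
  -- l > n, where the coefficient vanishes anyway.
  · intro h
    rw [MvPolynomial.coeff_monomial, if_pos rfl]
    refine expansionCoeff_eq_zero ?_
    simp only [Finset.mem_product, Finset.mem_range, not_and_or] at h
    omega

theorem homogeneousComponent_expansionPoly (n : ℕ) :
    MvPolynomial.homogeneousComponent n (expansionPoly n) =
      ∑ i ∈ Finset.range (n + 1),
        (-1) ^ i * MvPolynomial.X 0 ^ i * MvPolynomial.X 1 ^ (n - i) := by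
  have hterm : ∀ i, ((-1) ^ i * MvPolynomial.X 0 ^ i * MvPolynomial.X 1 ^ (n - i) :
      MvPolynomial (Fin 2) ℚ) = MvPolynomial.monomial
        (Finsupp.single 0 i + Finsupp.single 1 (n - i)) ((-1) ^ i) := by
    intro i
    rw [MvPolynomial.X_pow_eq_monomial, MvPolynomial.X_pow_eq_monomial, mul_assoc,
      MvPolynomial.monomial_mul, mul_one,
      show ((-1) ^ i : MvPolynomial (Fin 2) ℚ) = MvPolynomial.C ((-1) ^ i) by simp,
      MvPolynomial.C_mul_monomial, mul_one]
  ext d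
  rw [finsupp_fin_two d]
  set i := d 0
  set l := d 1
  simp only [hterm, MvPolynomial.coeff_homogeneousComponent, MvPolynomial.coeff_sum,
    MvPolynomial.coeff_monomial, single_add_single_inj, coeff_expansionPoly,
    degree_single_add_single]
  split_ifs with h
  · subst h
    rw [Finset.sum_eq_single i]
    · rw [if_pos ⟨rfl, by omega⟩, expansionCoeff_self]
    · intro j _ hj
      exact if_neg fun h => hj h.1
    · intro h
      exact absurd (Finset.mem_range.2 (by omega)) h
  -- For j ≤ n the subtraction n - j is not truncated, so every summand has total degree n and none
  -- can match d.
  · refine (Finset.sum_eq_zero fun j hj => if_neg fun h' => h ?_).symm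
    have := Finset.mem_range.1 hj
    omega

theorem totalDegree_expansionPoly (n : ℕ) : (expansionPoly n).totalDegree = n := by
  refine le_antisymm (Finset.sup_le fun d hd => ?_) ?_
  · rw [finsupp_fin_two d] at hd ⊢
    rw [MvPolynomial.mem_support_iff, coeff_expansionPoly] at hd
    rw [sum_single_add_single]
    exact not_lt.1 (mt expansionCoeff_eq_zero hd)
  -- The degree n is attained by w^n, whose coefficient is (-1)^0.
  · have h : (Finsupp.single 0 0 + Finsupp.single 1 n : Fin 2 →₀ ℕ) ∈
        (expansionPoly n).support := by
      rw [MvPolynomial.mem_support_iff, coeff_expansionPoly]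
      simpa using (expansionCoeff_self 0 n).trans_ne (by simp)
    have := MvPolynomial.le_totalDegree h
    rwa [sum_single_add_single, zero_add] at this

/-- The monomials w and w^n both occur, with coefficients 1/n! and 1, and have different degrees as
soon as n > 1. -/
theorem not_isHomogeneous_expansionPoly {n : ℕ} (hn : 1 < n) (m : ℕ) :
    ¬ (expansionPoly n).IsHomogeneous m := by
  intro h
  have key : ∀ l, expansionCoeff n 0 l ≠ 0 → l = m := by
    intro l hl
    rw [← coeff_expansionPoly] at hl
    by_contra hne
    exact hl (h.coeff_eq_zero (by rwa [degree_single_add_single, zero_add]))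
  have h1 := key 1 (by
    have : n ≠ 0 := by omega
    simp [expansionCoeff, coeff_exp, coeff_one, this, Nat.factorial_ne_zero])
  have h2 := key n (by simpa using (expansionCoeff_self 0 n).trans_ne (by simp))
  omega

end Polynomials

/-! ### Coefficients after the substitution z ↦ zw, and splitting sums over subsets -/

section Coefficients

variable {R : Type*} [CommRing R]

/-- The substitution sends z^i w^l to z^i w^(i+l), so the exponent of w records the total degree,
that is, the number of crossings being smoothed. The bound i ≤ k keeps k - i from being truncated.
-/
theorem coeffW_substZW (P : MvPolynomial (Fin 2) R) {i k : ℕ} (h : i ≤ k) :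
    coeffW k (substZW P) i = P.coeff (Finsupp.single 0 i + Finsupp.single 1 (k - i)) := by
  unfold coeffW
  induction P using MvPolynomial.induction_on' with
  | add p q hp hq => rw [map_add, MvPolynomial.coeff_add, MvPolynomial.coeff_add, hp, hq]
  | monomial d c =>
    have : substZW (MvPolynomial.monomial d c) = MvPolynomial.monomial
        (Finsupp.single 0 (d 0) + Finsupp.single 1 (d 0 + d 1)) c := by
      rw [substZW, MvPolynomial.aeval_monomial, Finsupp.prod_fintype _ _ (by simp),
        Fin.prod_univ_two]
      simp only [Matrix.cons_val_zero, Matrix.cons_val_one, MvPolynomial.algebraMap_eq, mul_pow,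
        MvPolynomial.X_pow_eq_monomial, MvPolynomial.monomial_mul, MvPolynomial.C_mul_monomial,
        mul_one, add_assoc, ← Finsupp.single_add]
    rw [this, MvPolynomial.coeff_monomial, MvPolynomial.coeff_monomial]
    refine if_congr ?_ rfl rfl
    rw [finsupp_fin_two d]
    simp only [single_add_single_inj, Finsupp.add_apply, Finsupp.single_eq_same,
      Finsupp.single_apply]
    simp
    omega

theorem coeff_eq_zero_of_totalDegree_lt_add (P : MvPolynomial (Fin 2) R) {i l : ℕ}
    (h : P.totalDegree < i + l) :
    P.coeff (Finsupp.single 0 i + Finsupp.single 1 l) = 0 := by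
  by_contra hne
  have := MvPolynomial.le_totalDegree (MvPolynomial.mem_support_iff.2 hne)
  rw [sum_single_add_single] at this
  omega

open Classical in
-- Used in two roles: with t the set of ∞-markers of a state, to split the sets T of smoothed
-- crossings, and with t = T, to split a Kauffman state into its parts on and off T.
theorem sum_powerset_inter_sdiff {α M : Type*} [AddCommMonoid M] {s t : Finset α} (h : t ⊆ s)
    (f : Finset α → Finset α → M) :
    ∑ u ∈ s.powerset, f (u ∩ t) (u \ t) =
      ∑ a ∈ t.powerset, ∑ b ∈ (s \ t).powerset, f a b := by
  rw [← Finset.sum_product']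
  refine Finset.sum_nbij' (fun u => (u ∩ t, u \ t)) (fun p => p.1 ∪ p.2) ?_ ?_ ?_ ?_ ?_
  · intro u hu
    simp only [Finset.mem_product, Finset.mem_powerset] at hu ⊢
    exact ⟨Finset.inter_subset_right, Finset.sdiff_subset_sdiff hu le_rfl⟩
  · rintro ⟨a, b⟩ hab
    simp only [Finset.mem_product, Finset.mem_powerset] at hab ⊢
    exact Finset.union_subset (hab.1.trans h) (hab.2.trans Finset.sdiff_subset)
  · intro u _
    rw [Finset.union_comm]
    exact Finset.sdiff_union_inter u t
  · rintro ⟨a, b⟩ hab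
    simp only [Finset.mem_product, Finset.mem_powerset] at hab
    ext x
    · have h1 := @hab.1 x
      have h2 := @hab.2 x
      simp only [Finset.mem_sdiff] at h2
      simp only [Finset.mem_inter, Finset.mem_union]
      tauto
    · have h1 := @hab.1 x
      have h2 := @hab.2 x
      simp only [Finset.mem_sdiff] at h2
      simp only [Finset.mem_sdiff, Finset.mem_union]
      tauto
  · intro u _
    rfl

end Coefficients

/-! ### Power series: state weights and the even loop factor -/

section Series

open PowerSeries

/-- Every state weight comes from a power series over ℚ, so coefficients can be computed over ℚ once
and for all; this also yields the rationality of the bracket coefficients. -/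
theorem expSubst_stateSum (R : Type*) [CommRing R] [Algebra ℚ R] (a b m : ℕ) :
    expSubst R ((-LaurentPolynomial.T 1) ^ a * (-LaurentPolynomial.T (-1)) ^ b *
        (-LaurentPolynomial.T 2 - LaurentPolynomial.T (-2)) ^ m) =
      PowerSeries.map (algebraMap ℚ R) ((-1) ^ (a + b) *
        (exp ℚ ^ a * evalNegHom (exp ℚ) ^ b) * (-exp ℚ ^ 2 - evalNegHom (exp ℚ) ^ 2) ^ m) := by
  have h1 : expSubst R (LaurentPolynomial.T 1) = exp R := by
    rw [expSubst, LaurentPolynomial.eval₂_T, zpow_one]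
    rfl
  have h2 : expSubst R (LaurentPolynomial.T (-1)) = evalNegHom (exp R) := by
    rw [expSubst, LaurentPolynomial.eval₂_T, zpow_neg_one]
    rfl
  have h3 : (LaurentPolynomial.T 2 : LaurentPolynomial R) = LaurentPolynomial.T 1 ^ 2 := by
    simp [LaurentPolynomial.T_pow]
  have h4 : (LaurentPolynomial.T (-2) : LaurentPolynomial R) = LaurentPolynomial.T (-1) ^ 2 := by
    simp [LaurentPolynomial.T_pow]
  have h5 : PowerSeries.map (algebraMap ℚ R) (evalNegHom (exp ℚ)) = evalNegHom (exp R) := by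
    ext n
    simp [evalNegHom, coeff_rescale, coeff_exp]
  simp only [h3, h4, map_mul, map_pow, map_neg, map_sub, map_one, h1, h2, h5, map_exp]
  rw [neg_pow (exp R) a, neg_pow (evalNegHom (exp R)) b]
  ring

theorem loopCoeff_eq (j m : ℕ) :
    loopCoeff j m = coeff (2 * j) ((-exp ℚ ^ 2 - evalNegHom (exp ℚ) ^ 2) ^ m) := by
  have := expSubst_stateSum ℚ 0 0 m
  simp only [pow_zero, one_mul, add_zero, Algebra.algebraMap_self, PowerSeries.map_id] at this
  rw [loopCoeff, this]
  rfl

/-- The map h ↦ -h exchanges e^h and e^(-h), hence fixes the loop factor; an odd coefficient equals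
its own negative. -/
theorem coeff_loop_odd (m : ℕ) {n : ℕ} (hn : Odd n) :
    coeff n ((-exp ℚ ^ 2 - evalNegHom (exp ℚ) ^ 2) ^ m) = 0 := by
  set G : PowerSeries ℚ := (-exp ℚ ^ 2 - evalNegHom (exp ℚ) ^ 2) ^ m with hG
  have hE : evalNegHom (evalNegHom (exp ℚ)) = exp ℚ := by
    simp [evalNegHom, rescale_rescale]
  have h : evalNegHom G = G := by
    simp only [hG, map_pow, map_sub, map_neg, hE]
    ring
  have h' := congrArg (coeff n) h
  rw [evalNegHom, coeff_rescale, hn.neg_one_pow] at h'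
  linarith

theorem coeff_mul_loop (f : PowerSeries ℚ) (m n : ℕ) :
    coeff n (f * (-exp ℚ ^ 2 - evalNegHom (exp ℚ) ^ 2) ^ m) =
      ∑ j ∈ Finset.range (n / 2 + 1), coeff (n - 2 * j) f * loopCoeff j m := by
  rw [mul_comm, coeff_mul, Finset.Nat.sum_antidiagonal_eq_sum_range_succ
    (fun a b => coeff a ((-exp ℚ ^ 2 - evalNegHom (exp ℚ) ^ 2) ^ m) * coeff b f)]
  symm
  -- The sum over j is the convolution restricted to even exponents 2j ≤ n of the loop factor; the
  -- odd ones contribute nothing.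
  refine Finset.sum_of_injOn (fun j => 2 * j) (fun a _ b _ h => by simpa using h) ?_ ?_ ?_
  · intro j hj
    simp only [Finset.coe_range, Set.mem_Iio] at hj ⊢
    omega
  · intro k hk hk'
    rw [coeff_loop_odd, zero_mul]
    by_contra hodd
    obtain ⟨j, rfl⟩ := (Nat.not_odd_iff_even.1 hodd).two_dvd
    refine hk' ⟨j, ?_, rfl⟩
    simp only [Finset.coe_range, Set.mem_Iio, Finset.mem_range] at hk ⊢
    omega
  · intro j _
    rw [loopCoeff_eq, mul_comm]

open Classical in
-- Expand each of the |s| factors as 1 + (x - 1), with x = e^(-h) on t and x = e^h off t; u is the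
-- set of factors from which x - 1 is chosen.
theorem coeff_exp_pow_mul_exp_neg_pow {α : Type*} {s t : Finset α} (h : t ⊆ s) (n : ℕ) :
    coeff n (exp ℚ ^ (s.card - t.card) * evalNegHom (exp ℚ) ^ t.card) =
      ∑ u ∈ s.powerset, expansionCoeff n (u ∩ t).card (u \ t).card := by
  rw [sum_powerset_inter_sdiff h (fun a b => expansionCoeff n a.card b.card),
    ← Finset.card_sdiff_of_subset h]
  have key : ∀ (x : PowerSeries ℚ) (v : Finset α),
      x ^ v.card = ∑ a ∈ v.powerset, (x - 1) ^ a.card := by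
    intro x v
    -- This is the binomial theorem for ((x - 1) + 1)^|v|, indexed by subsets.
    simpa using (Finset.sum_pow_mul_eq_add_pow (x - 1) 1 v).symm
  rw [key (exp ℚ), key (evalNegHom (exp ℚ)), mul_comm, Finset.sum_mul_sum]
  simp only [map_sum, expansionCoeff]

end Series

end KauffmanExpansion

namespace KauffmanExpansion

/-! ### Resolutions and the expansion of the bracket -/

theorem Diagram.ext_of_eq {F : Type*} [TopologicalSpace F] [ChartedSpace HalfPlane F] {r : ℕ}
    {β : BoundaryParametrization F r} {D D' : Diagram β} (h1 : D.carrier = D'.carrier)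
    (h2 : D.crossings = D'.crossings) (h3 : D.chart = D'.chart) (h4 : D.marked = D'.marked) :
    D = D' := by
  cases D; cases D'
  dsimp only at h1 h2 h3 h4
  subst h1 h2 h3 h4
  rfl

section Expansion

variable {F : Type*} [TopologicalSpace F] [ChartedSpace HalfPlane F] [OrientedSurface F] {r : ℕ}
  {β : BoundaryParametrization F r}

namespace Diagram

variable {D : Diagram β}

open Classical in
theorem crossings_smooth (T I : Finset F) : (D.smooth T I).crossings = D.crossings \ T := rfl

open Classical in
-- Smoothings at different crossings take place in disjoint discs, and the remaining discs are
-- carried along unchanged. The two-stage and the one-stage smoothing are therefore equal as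
-- diagrams, not merely isotopic.
theorem resolve_smooth (T I J K : Finset F)
    (hI : ∀ c ∈ T, (c ∈ I ↔ c ∈ K)) (hJ : ∀ c ∈ D.crossings, c ∉ T → (c ∈ J ↔ c ∈ K)) :
    (D.smooth T I).resolve J = D.resolve K := by
  refine ext_of_eq ?_ ?_ rfl ?_
  · change (D.smooth T I).smoothCarrier (D.crossings \ T) J = D.smoothCarrier D.crossings K
    ext p
    -- Off all cores nothing has changed. In the core of c, the marker was set by I in the first
    -- stage if c ∈ T and by J in the second stage otherwise; both agree with K there.
    by_cases h : ∀ c ∈ D.crossings, c ∈ D.crossings → p ∉ D.chart c '' core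
    · have h' : ∀ c ∈ (D.smooth T I).crossings, c ∈ D.crossings \ T →
          p ∉ (D.smooth T I).chart c '' core :=
        fun c _ hc => h c (Finset.mem_sdiff.1 hc).1 (Finset.mem_sdiff.1 hc).1
      rw [smoothCarrier_of_forall h, smoothCarrier_of_forall h']
      exact smoothCarrier_of_forall fun c hc _ => h c hc hc
    · push Not at h
      obtain ⟨c, hc, -, x, hx, rfl⟩ := h
      rw [smoothCarrier_chart_of_mem hc hc]
      by_cases hcT : c ∈ T
      · have h' : ∀ c' ∈ (D.smooth T I).crossings, c' ∈ D.crossings \ T →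
            D.chart c x ∉ (D.smooth T I).chart c' '' core := by
          intro c' _ hc' hmem
          have hc' := Finset.mem_sdiff.1 hc'
          exact hc'.2 (((chart_mem_image hc hc'.1).1 hmem).1 ▸ hcT)
        rw [smoothCarrier_of_forall h']
        refine (smoothCarrier_chart_of_mem hc hcT x).trans ?_
        rw [propext (hI c hcT)]
      · have hc' : c ∈ D.crossings \ T := Finset.mem_sdiff.2 ⟨hc, hcT⟩
        refine (smoothCarrier_chart_of_mem (D := D.smooth T I) hc' hc' x).trans ?_
        rw [propext (hJ c hc hcT)]
  · change (D.crossings \ T) \ (D.crossings \ T) = D.crossings \ D.crossings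
    simp
  · change (D.marked \ T) \ (D.crossings \ T) = D.marked \ D.crossings
    -- Marked crossings are crossings, so none survive on either side.
    rw [Finset.sdiff_eq_empty_iff_subset.2 D.marked_subset,
      Finset.sdiff_eq_empty_iff_subset.2 (Finset.sdiff_subset_sdiff D.marked_subset le_rfl)]

theorem stateCurves_eq_of_resolve_eq {D D' : Diagram β} {J K : Finset F}
    (h : D.resolve J = D'.resolve K) :
    D.stateCurves J = D'.stateCurves K ∧ D.mu J = D'.mu K := by
  constructor
  · unfold stateCurves
    simp only [h]
    rfl
  · unfold mu
    rw [h]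

end Diagram

/-! ### The composite of projection and resolution operator as a state sum -/

variable {R : Type*} [CommRing R]

/-- The sum over k up to the degree of P can be traded for a sum over all subsets: coefficients
vanish beyond the degree, and there are no subsets beyond the number of marked crossings. -/
theorem chi_single (P : MvPolynomial (Fin 2) R) (D : Diagram β) :
    chi β P (Finsupp.single (Quotient.mk _ D) 1) =
      ∑ T ∈ D.marked.powerset, (-1 : R) ^ T.card • ∑ I ∈ T.powerset,
        Finsupp.single (Quotient.mk _ (D.smooth T I))
          (P.coeff (Finsupp.single 0 I.card + Finsupp.single 1 (T.card - I.card))) := by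
  set g : ℕ → (DiagramClass β →₀ R) := fun k => ∑ T ∈ D.marked.powersetCard k,
    (-1 : R) ^ T.card • ∑ I ∈ T.powerset, Finsupp.single (Quotient.mk _ (D.smooth T I))
      (P.coeff (Finsupp.single 0 I.card + Finsupp.single 1 (T.card - I.card))) with hg
  have h1 : ∀ k, chiDegree β k (coeffW k (substZW P)) (Finsupp.single (Quotient.mk _ D) 1) =
      g k := by
    intro k
    rw [chiDegree, Finsupp.linearCombination_single, one_smul, Quotient.lift_mk, Diagram.chi,
      Finset.smul_sum]
    refine Finset.sum_congr rfl fun T hT => ?_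
    obtain ⟨-, rfl⟩ := Finset.mem_powersetCard.1 hT
    congr 1
    refine Finset.sum_congr rfl fun I hI => ?_
    rw [coeffW_substZW P (Finset.card_le_card (Finset.mem_powerset.1 hI))]
  have h2 : ∀ k, P.totalDegree < k → g k = 0 := by
    intro k hk
    refine Finset.sum_eq_zero fun T hT => ?_
    obtain ⟨-, rfl⟩ := Finset.mem_powersetCard.1 hT
    rw [Finset.sum_eq_zero, smul_zero]
    intro I hI
    have := Finset.card_le_card (Finset.mem_powerset.1 hI)
    rw [coeff_eq_zero_of_totalDegree_lt_add P (by omega), Finsupp.single_zero]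
  have h3 : ∀ k, D.marked.card < k → g k = 0 := by
    intro k hk
    simp only [hg, Finset.powersetCard_eq_empty.2 hk, Finset.sum_empty]
  rw [chi, LinearMap.sum_apply, Finset.sum_powerset, Finset.sum_congr rfl fun k _ => h1 k]
  change ∑ k ∈ Finset.range _, g k = ∑ k ∈ Finset.range _, g k
  rcases le_total P.totalDegree D.marked.card with h | h
  · refine Finset.sum_subset (Finset.range_mono (by omega)) fun k _ hk => h2 k ?_
    simpa using hk
  · refine (Finset.sum_subset (Finset.range_mono (by omega)) fun k _ hk => h3 k ?_).symm
    simpa using hk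

open Classical in
-- By `Diagram.resolve_smooth`, states J of the partly smoothed diagram are the states of D that
-- restrict to I on T.
theorem projection_smooth (φ : ℕ → R) (D : Diagram β) {T : Finset F} (hT : T ⊆ D.crossings)
    (I : Finset F) (hI : I ⊆ T) :
    (D.smooth T I).projection φ = (-1 : R) ^ (D.crossings.card - T.card) •
      ∑ J ∈ (D.crossings \ T).powerset,
        Finsupp.single (D.stateCurves (I ∪ J)) (φ (D.mu (I ∪ J))) := by
  rw [Diagram.projection, Diagram.crossings_smooth, Finset.card_sdiff_of_subset hT]
  refine congrArg _ (Finset.sum_congr rfl fun J hJ => ?_)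
  have hJ := Finset.mem_powerset.1 hJ
  have hr : (D.smooth T I).resolve J = D.resolve (I ∪ J) := by
    refine Diagram.resolve_smooth T I J (I ∪ J) (fun c hc => ?_) fun c hc hcT => ?_
    · have : c ∉ J := fun h => (Finset.mem_sdiff.1 (hJ h)).2 hc
      simp [this]
    · have : c ∉ I := fun h => hcT (hI h)
      simp [this]
  obtain ⟨h1, h2⟩ := Diagram.stateCurves_eq_of_resolve_eq hr
  rw [h1, h2]

open Classical in
-- For fixed T, the pair (I, J) of markers on T and off T is one Kauffman state K = I ∪ J of D.
-- Since D is real, T runs over all sets of crossings.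
theorem pushforward_chi_single (φ : ℕ → R) (P : MvPolynomial (Fin 2) R) (D : Diagram β)
    (hD : D.IsReal) :
    pushforward β φ (chi β P (Finsupp.single (Quotient.mk _ D) 1)) =
      ∑ K ∈ D.crossings.powerset, Finsupp.single (D.stateCurves K)
        ((-1) ^ D.crossings.card * (∑ T ∈ D.crossings.powerset, P.coeff
          (Finsupp.single 0 (T ∩ K).card + Finsupp.single 1 (T \ K).card)) * φ (D.mu K)) := by
  have hD : D.marked = D.crossings := hD
  rw [chi_single, map_sum, hD]
  simp only [Finset.mul_sum, Finset.sum_mul, Finsupp.single_finsetSum]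
  -- With T as outer index, both sides can be compared one T at a time.
  rw [Finset.sum_comm]
  refine Finset.sum_congr rfl fun T hT => ?_
  have hT := Finset.mem_powerset.1 hT
  rw [map_smul, map_sum]
  have h1 : ∀ I ∈ T.powerset, pushforward β φ (Finsupp.single (Quotient.mk _ (D.smooth T I))
      (P.coeff (Finsupp.single 0 I.card + Finsupp.single 1 (T.card - I.card)))) =
      ∑ J ∈ (D.crossings \ T).powerset, Finsupp.single (D.stateCurves (I ∪ J))
        ((-1) ^ (D.crossings.card - T.card) *
        P.coeff (Finsupp.single 0 I.card + Finsupp.single 1 (T.card - I.card)) *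
          φ (D.mu (I ∪ J))) := by
    intro I hI
    rw [pushforward, Finsupp.linearCombination_single, Quotient.lift_mk,
      projection_smooth φ D hT I (Finset.mem_powerset.1 hI), smul_smul, Finset.smul_sum]
    refine Finset.sum_congr rfl fun J _ => ?_
    rw [Finsupp.smul_single, smul_eq_mul]
    congr 1
    ring
  rw [Finset.sum_congr rfl h1, ← sum_powerset_inter_sdiff hT (fun I J => Finsupp.single
    (D.stateCurves (I ∪ J)) ((-1) ^ (D.crossings.card - T.card) *
        P.coeff (Finsupp.single 0 I.card + Finsupp.single 1 (T.card - I.card)) *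
          φ (D.mu (I ∪ J)))), Finset.smul_sum]
  refine Finset.sum_congr rfl fun K _ => ?_
  have hu : K ∩ T ∪ K \ T = K := by
    rw [Finset.union_comm]
    exact Finset.sdiff_union_inter K T
  have hc : T.card - (K ∩ T).card = (T \ K).card := by
    rw [Finset.inter_comm, ← Finset.card_sdiff_add_card_inter T K, Nat.add_sub_cancel]
  -- The sign of χ times the sign of the projection of the partly smoothed diagram.
  have hs : (-1 : R) ^ D.crossings.card =
      (-1) ^ T.card * (-1) ^ (D.crossings.card - T.card) := by
    rw [← pow_add, Nat.add_sub_cancel' (Finset.card_le_card hT)]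
  rw [hu, hc, Finset.inter_comm K T, Finsupp.smul_single, smul_eq_mul, hs]
  congr 1
  ring

/-! ### The bracket coefficients as a state sum, and comparison of the two sides -/

/-- The coefficient of `h ^ n` in the weight of the Kauffman state of `D` whose `∞`-markers are
at `K`. -/
def stateCoeff (D : Diagram β) (n : ℕ) (K : Finset F) : ℚ :=
  PowerSeries.coeff n ((-1) ^ D.crossings.card *
    (PowerSeries.exp ℚ ^ (D.crossings.card - K.card) *
      PowerSeries.evalNegHom (PowerSeries.exp ℚ) ^ K.card) *
    (-PowerSeries.exp ℚ ^ 2 - PowerSeries.evalNegHom (PowerSeries.exp ℚ) ^ 2) ^ D.mu K)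

theorem bracketCoeff_mk (R : Type*) [CommRing R] [Algebra ℚ R] (D : Diagram β) (n : ℕ) :
    bracketCoeff R n (Quotient.mk _ D) = ∑ K ∈ D.crossings.powerset,
      Finsupp.single (D.stateCurves K) (algebraMap ℚ R (stateCoeff D n K)) := by
  rw [bracketCoeff, bracket, Quotient.lift_mk, Diagram.bracket]
  refine (Finsupp.mapRange_finsetSum
    ((PowerSeries.coeff (R := R) n).toAddMonoidHom.comp (expSubst R).toAddMonoidHom) _ _).trans ?_
  refine Finset.sum_congr rfl fun K hK => ?_
  rw [Finsupp.mapRange_single]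
  congr 1
  change PowerSeries.coeff n (expSubst R _) = _
  rw [expSubst_stateSum, PowerSeries.coeff_map,
    Nat.sub_add_cancel (Finset.card_le_card (Finset.mem_powerset.1 hK))]
  rfl

open Classical in
theorem stateCoeff_eq (D : Diagram β) (n : ℕ) {K : Finset F} (hK : K ⊆ D.crossings) :
    stateCoeff D n K = ∑ j ∈ Finset.range (n / 2 + 1), (-1) ^ D.crossings.card *
      (∑ T ∈ D.crossings.powerset, expansionCoeff (n - 2 * j) (T ∩ K).card (T \ K).card) *
        loopCoeff j (D.mu K) := by
  rw [stateCoeff, coeff_mul_loop]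
  refine Finset.sum_congr rfl fun j _ => ?_
  rw [← coeff_exp_pow_mul_exp_neg_pow hK]
  congr 1
  -- The sign is a power series on one side and a rational number on the other; by parity it is 1 or
  -- -1 on both.
  rcases Nat.even_or_odd D.crossings.card with he | he <;> simp [he.neg_one_pow]

/-- Both sides are sums over Kauffman states K carried by the same curve systems, so it suffices to
match the scalars at each K, which is `stateCoeff_eq` transported along ℚ → R. -/
theorem bracketCoeff_eq_sum (R : Type*) [CommRing R] [Algebra ℚ R] (D : Diagram β)
    (hD : D.IsReal) (n : ℕ) :
    bracketCoeff R n (Quotient.mk _ D) = ∑ j ∈ Finset.range (n / 2 + 1),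
      pushforward β (fun i => algebraMap ℚ R (loopCoeff j i))
        (chi β (MvPolynomial.map (algebraMap ℚ R) (expansionPoly (n - 2 * j)))
          (Finsupp.single (Quotient.mk _ D) 1)) := by
  classical
  rw [bracketCoeff_mk]
  simp only [pushforward_chi_single _ _ D hD]
  rw [Finset.sum_comm]
  refine Finset.sum_congr rfl fun K hK => ?_
  rw [stateCoeff_eq D n (Finset.mem_powerset.1 hK), map_sum, Finsupp.single_finsetSum]
  refine Finset.sum_congr rfl fun j _ => ?_
  congr 1
  simp only [map_mul, map_pow, map_neg, map_one, map_sum, MvPolynomial.coeff_map,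
    coeff_expansionPoly]

theorem bracketCoeff_eq_mapRange (R : Type*) [CommRing R] [Algebra ℚ R] (D : DiagramClass β)
    (n : ℕ) : bracketCoeff R n D =
      (bracketCoeff ℚ n D).mapRange (algebraMap ℚ R) (map_zero _) := by
  obtain ⟨D, rfl⟩ := Quotient.exists_rep D
  rw [bracketCoeff_mk, bracketCoeff_mk]
  refine Eq.trans ?_ (Finsupp.mapRange_finsetSum (algebraMap ℚ R).toAddMonoidHom _ _).symm
  refine Finset.sum_congr rfl fun K _ => ?_
  rw [Finsupp.mapRange_single]
  rfl

end Expansion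

end KauffmanExpansion

end

theorem mainTheorem1 :
    ∃ P : ℕ → MvPolynomial (Fin 2) ℚ,
      (∀ n, (P n).totalDegree = n) ∧
      (∀ n, 1 < n → ∀ m, ¬ (P n).IsHomogeneous m) ∧
      (∀ n, MvPolynomial.homogeneousComponent n (P n) =
        ∑ i ∈ Finset.range (n + 1),
          (-1) ^ i * MvPolynomial.X 0 ^ i * MvPolynomial.X 1 ^ (n - i)) ∧
      ∀ (R : Type*) [CommRing R] [Algebra ℚ R]
        (F : Type*) [TopologicalSpace F] [ChartedSpace KauffmanExpansion.HalfPlane F]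
        [KauffmanExpansion.OrientedSurface F]
        (r : ℕ) (β : KauffmanExpansion.BoundaryParametrization F r),
        ∀ D ∈ KauffmanExpansion.realDiagrams β, ∀ n : ℕ,
          KauffmanExpansion.bracketCoeff R n D =
            ∑ j ∈ Finset.range (n / 2 + 1),
              KauffmanExpansion.pushforward β
                (fun i => algebraMap ℚ R (KauffmanExpansion.loopCoeff j i))
                (KauffmanExpansion.chi β
                  (MvPolynomial.map (algebraMap ℚ R) (P (n - 2 * j)))
                  (Finsupp.single D 1)) ∧
          ∃ y : KauffmanExpansion.CurveSystem β →₀ ℚ,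
            KauffmanExpansion.bracketCoeff R n D =
              y.mapRange (algebraMap ℚ R) (map_zero _) := by
  refine ⟨KauffmanExpansion.expansionPoly, KauffmanExpansion.totalDegree_expansionPoly,
    fun n hn m => KauffmanExpansion.not_isHomogeneous_expansionPoly hn m,
    KauffmanExpansion.homogeneousComponent_expansionPoly, ?_⟩
  intro R _ _ F _ _ _ r β x hx n
  obtain ⟨D, hD, rfl⟩ := hx
  -- The rational witness is the bracket coefficient computed over ℚ.
  exact ⟨KauffmanExpansion.bracketCoeff_eq_sum R D hD n, _,
    KauffmanExpansion.bracketCoeff_eq_mapRange R _ n⟩
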